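/- Let $d\in\mathbb N$ and $\mathbb T^d=\mathbb R^d/2\pi\mathbb Z^d$. For $k\in\mathbb Z^d$ put $\varphi_k(x)=(2\pi)^{-d/2}e^{ik\cdot x}$ and $\lambda_k=|k|^2$, and let $$H^1(\mathbb T^d)=\Big\{w\in L^2(\mathbb T^d,\mathbb R)\;\Big|\;\sum_{k\in\mathbb Z^d}\lambda_k|\langle w,\varphi_k\rangle|^2<\infty\Big\},\qquad \|w\|_{H^1}^2=\|w\|_{L^2}^2+\sum_{k}\lambda_k|\langle w,\varphi_k\rangle|^2 .$$ Consider the controlled wave equation $$\partial_t^2 w(x,t)=\Big(\Delta+\sum_{j=0}^{2d}p_j(t)\mu_j(x)\Big)w(x,t),\qquad x\in\mathbb T^d,$$ where $(\mu_0,\dots,\mu_{2d})=(1,\cos x_1,\sin x_1,\dots,\cos x_d,\sin x_d)$ and $p=(p_0,\dots,p_{2d})$ is the control. With $\mathcal A=\begin{pmatrix}0&I\\ \Delta&0\end{pmatrix}$, $\mathcal B=\begin{pmatrix}0&0\\ I&0\end{pmatrix}$, its solution on $[0,\tau]$ with initial state $W_0=(w_0,\dot w_0)\in H^1\times L^2(\mathbb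 T^d,\mathbb R)$ is the function $W=(w,\partial_t w)\in C^0([0,\tau],H^1\times L^2)$ with $$W(t)=e^{t\mathcal A}W_0+\int_0^te^{(t-s)\mathcal A}\Big(\sum_{j=0}^{2d}p_j(s)\mu_j\mathcal B\Big)W(s)\,ds,\qquad t\in[0,\tau],$$ where the group $e^{t\mathcal A}$ on $H^1\times L^2$ is given by the Fourier series of the free wave evolution. Lemma. Let $(w_0,\dot w_0)\in H^1\times L^2(\mathbb T^d,\mathbb R)$ and $\phi\in L^2(\mathbb T^d,\mathbb R)$; if $d\ge 2$, suppose that $w_0\phi\in L^2(\mathbb T^d)$. Then $w_0\phi\in L^2(\mathbb T^d)$ (also when $d=1$), and for all $\varepsilon,T>0$ there exist $\tau\in[0,T)$ and a piecewise constant control $p:[0,\tau]\to\mathbb R^{2d+1}$ such that the solution $(w,\partial_t w)$ on $[0,\tau]$ associated with $p$ and with the initial state $(w_0,\dot w_0)$ exists and satisfies $$\left\|\begin{pmatrix}w(\cdot,\tau)\\ \partial_t w(\cdot,\tau)\end{pmatrix}-\begin{pmatrix}w_0\\ \dot w_0+w_0\phi\end{pmatrix}\right\|_{H^1\times L^2(\mathbb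 T^d)}<\varepsilon .$$ -/

import Mathlib

open MeasureTheory Set
open scoped ENNReal ComplexConjugate

noncomputable section

namespace TorusWave

instance twoPiPos : Fact (0 < 2 * Real.pi) := ⟨Real.two_pi_pos⟩

/-- The torus `ℝ^d / 2πℤ^d`, with the product of the Lebesgue measures (total mass `(2π)^d`). -/
abbrev Torus (d : ℕ) : Type := Fin d → AddCircle (2 * Real.pi)

/-- The real Hilbert space `L²(𝕋^d, ℝ)`. -/
abbrev L2 (d : ℕ) : Type := Lp ℝ 2 (volume : Measure (Torus d))

/-- The eigenfunction `φ_k(x) = (2π)^{-d/2} e^{i k·x}` of the Laplacian. -/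
def eigenfunction {d : ℕ} (k : Fin d → ℤ) : C(Torus d, ℂ) where
  toFun x := (((2 * Real.pi) ^ (-(d : ℝ) / 2) : ℝ) : ℂ) * ∏ i, fourier (k i) (x i)
  continuous_toFun := by fun_prop

/-- The eigenvalue `λ_k = |k|²` of `-Δ`. -/
def eigenvalue {d : ℕ} (k : Fin d → ℤ) : ℝ := ∑ i, (k i : ℝ) ^ 2

/-- The frequency `√λ_k = |k|`. -/
def freq {d : ℕ} (k : Fin d → ℤ) : ℝ := Real.sqrt (eigenvalue k)

/-- The Fourier coefficient `⟨w, φ_k⟩ = ∫ w(x) conj(φ_k(x)) dx`. -/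
def coeff {d : ℕ} (w : L2 d) (k : Fin d → ℤ) : ℂ :=
  ∫ x, conj (eigenfunction k x) * ((w x : ℝ) : ℂ)

theorem coeff_eq_inner {d : ℕ} (w : L2 d) (k : Fin d → ℤ) :
    coeff w k = inner ℂ (ContinuousMap.toLp (E := ℂ) 2 volume ℂ (eigenfunction k))
      (Complex.ofRealCLM.compLpL 2 (volume : Measure (Torus d)) w) := by
  rw [L2.inner_def, coeff]
  apply integral_congr_ae
  filter_upwards [ContinuousMap.coeFn_toLp (p := 2) (E := ℂ) (𝕜 := ℂ)
    (volume : Measure (Torus d)) (eigenfunction k),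
    Complex.ofRealCLM.coeFn_compLpL w] with x h1 h2
  rw [h1, h2]
  simp [mul_comm]

theorem coeff_add {d : ℕ} (v w : L2 d) (k : Fin d → ℤ) :
    coeff (v + w) k = coeff v k + coeff w k := by
  simp only [coeff_eq_inner, map_add, inner_add_right]

theorem coeff_smul {d : ℕ} (c : ℝ) (w : L2 d) (k : Fin d → ℤ) :
    coeff (c • w) k = c * coeff w k := by
  rw [coeff, coeff, ← integral_const_mul]
  apply integral_congr_ae
  filter_upwards [Lp.coeFn_smul c w] with x hx
  rw [hx]
  simp only [Pi.smul_apply, smul_eq_mul, Complex.ofReal_mul]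
  ring

theorem continuous_coeff {d : ℕ} (k : Fin d → ℤ) : Continuous fun w : L2 d => coeff w k := by
  simp only [coeff_eq_inner]
  fun_prop

/-- The functions `w ∈ L²(𝕋^d, ℝ)` with `∑_k λ_k |⟨w, φ_k⟩|² < ∞`. -/
def h1Submodule (d : ℕ) : Submodule ℝ (L2 d) where
  carrier := {w | Summable fun k => eigenvalue k * ‖coeff w k‖ ^ 2}
  zero_mem' := by
    have h : ∀ k, coeff (0 : L2 d) k = 0 := fun k => by simp [coeff_eq_inner]
    simp [h, summable_zero]
  add_mem' := by
    intro v w hv hw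
    refine Summable.of_nonneg_of_le (fun k => ?_) (fun k => ?_) ((hv.add hw).mul_left 2)
    · exact mul_nonneg (Finset.sum_nonneg fun i _ => sq_nonneg _) (sq_nonneg _)
    · have h0 : 0 ≤ eigenvalue k := Finset.sum_nonneg fun i _ => sq_nonneg _
      have h1 : ‖coeff (v + w) k‖ ^ 2 ≤ 2 * (‖coeff v k‖ ^ 2 + ‖coeff w k‖ ^ 2) := by
        rw [coeff_add]
        have h2 := norm_add_le (coeff v k) (coeff w k)
        nlinarith [norm_nonneg (coeff v k + coeff w k), sq_nonneg (‖coeff v k‖ - ‖coeff w k‖)]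
      nlinarith [mul_le_mul_of_nonneg_left h1 h0]
  smul_mem' := by
    intro c w hw
    refine (Summable.mul_left (c ^ 2) hw).congr fun k => ?_
    rw [coeff_smul, norm_mul, Complex.norm_real, mul_pow, Real.norm_eq_abs, sq_abs]
    ring

/-- The Sobolev space `H¹(𝕋^d, ℝ)`. It carries its own norm, defined below, not that of `L²`. -/
def H1 (d : ℕ) : Type := h1Submodule d

instance H1.addCommGroup (d : ℕ) : AddCommGroup (H1 d) := inferInstanceAs (AddCommGroup (h1Submodule d))

instance H1.module (d : ℕ) : Module ℝ (H1 d) := inferInstanceAs (Module ℝ (h1Submodule d))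

/-- The inclusion of `H¹` in `L²`. -/
def H1.toL2 {d : ℕ} : H1 d →ₗ[ℝ] L2 d := (h1Submodule d).subtype

theorem H1.summable {d : ℕ} (w : H1 d) :
    Summable fun k => eigenvalue k * ‖coeff w.toL2 k‖ ^ 2 := w.2

theorem eigenvalue_nonneg {d : ℕ} (k : Fin d → ℤ) : 0 ≤ eigenvalue k :=
  Finset.sum_nonneg fun _ _ => sq_nonneg _

theorem norm_freq_mul_sq {d : ℕ} (w : L2 d) (k : Fin d → ℤ) :
    ‖(freq k : ℂ) * coeff w k‖ ^ 2 = eigenvalue k * ‖coeff w k‖ ^ 2 := by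
  rw [norm_mul, Complex.norm_real, mul_pow, Real.norm_eq_abs, sq_abs, freq,
    Real.sq_sqrt (eigenvalue_nonneg k)]

/-- The sequence `(√λ_k ⟨w, φ_k⟩)_k ∈ ℓ²(ℤ^d, ℂ)` of a function `w ∈ H¹`. -/
def H1.freqSeq {d : ℕ} : H1 d →ₗ[ℝ] lp (fun _ : Fin d → ℤ => ℂ) 2 where
  toFun w := ⟨fun k => (freq k : ℂ) * coeff w.toL2 k, by
    refine memℓp_gen ?_
    refine w.summable.congr fun k => ?_
    rw [← norm_freq_mul_sq]
    simp⟩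
  map_add' v w := by
    ext k
    simp only [map_add, coeff_add, mul_add]
    rfl
  map_smul' c w := by
    ext k
    simp [coeff_smul]
    ring

/-- The map `w ↦ (w, (√λ_k ⟨w, φ_k⟩)_k)`, whose target has the norm
`‖(u, c)‖² = ‖u‖² + ∑_k |c_k|²`. -/
def H1.graph {d : ℕ} : H1 d →ₗ[ℝ] WithLp 2 (L2 d × lp (fun _ : Fin d → ℤ => ℂ) 2) :=
  (WithLp.linearEquiv 2 ℝ (L2 d × lp (fun _ : Fin d → ℤ => ℂ) 2)).symm.toLinearMap ∘ₗ
    H1.toL2.prod H1.freqSeq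

theorem H1.toL2_injective {d : ℕ} : Function.Injective (H1.toL2 (d := d)) :=
  Subtype.val_injective

theorem H1.graph_injective {d : ℕ} : Function.Injective (H1.graph (d := d)) := by
  intro v w h
  apply H1.toL2_injective
  exact congrArg (fun z => (WithLp.ofLp z).1) h

instance H1.normedAddCommGroup (d : ℕ) : NormedAddCommGroup (H1 d) :=
  NormedAddCommGroup.induced (H1 d) _ H1.graph H1.graph_injective

instance H1.normedSpace (d : ℕ) : NormedSpace ℝ (H1 d) :=
  NormedSpace.induced ℝ (H1 d) _ H1.graph

/-- The `H¹` norm: `‖w‖² = ‖w‖²_{L²} + ∑_k λ_k |⟨w, φ_k⟩|²`. -/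
theorem H1.norm_sq {d : ℕ} (w : H1 d) :
    ‖w‖ ^ 2 = ‖w.toL2‖ ^ 2 + ∑' k, eigenvalue k * ‖coeff w.toL2 k‖ ^ 2 := by
  have h : ‖w‖ = ‖H1.graph w‖ := rfl
  rw [h, WithLp.prod_norm_sq_eq_of_L2]
  congr 1
  have h2 := lp.norm_rpow_eq_tsum (p := 2) (by norm_num) (H1.freqSeq w)
  simp only [ENNReal.toReal_ofNat, Real.rpow_ofNat] at h2
  refine h2.trans (tsum_congr fun k => ?_)
  exact norm_freq_mul_sq _ _

theorem H1.isClosed_range_graph {d : ℕ} : IsClosed (range (H1.graph (d := d))) := by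
  have h : range (H1.graph (d := d)) =
      {z | ∀ k, (WithLp.ofLp z).2 k = (freq k : ℂ) * coeff (WithLp.ofLp z).1 k} := by
    ext z
    constructor
    · rintro ⟨w, rfl⟩ k
      rfl
    · intro hz
      have hs : (WithLp.ofLp z).1 ∈ h1Submodule d := by
        have := (lp.memℓp (WithLp.ofLp z).2).summable (by norm_num)
        refine this.congr fun k => ?_
        rw [hz k, ← norm_freq_mul_sq]
        simp
      refine ⟨⟨(WithLp.ofLp z).1, hs⟩, ?_⟩
      apply WithLp.ofLp_injective
      refine Prod.ext rfl ?_
      ext k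
      exact (hz k).symm
  rw [h, Set.ofPred_forall]
  refine isClosed_iInter fun k => isClosed_eq ?_ ?_
  · exact ((lp.evalCLM ℝ (fun _ : Fin d → ℤ => ℂ) 2 k).continuous).comp
      (continuous_snd.comp (WithLp.prod_continuous_ofLp 2 _ _))
  · exact continuous_const.mul ((continuous_coeff k).comp
      (continuous_fst.comp (WithLp.prod_continuous_ofLp 2 _ _)))

instance H1.completeSpace (d : ℕ) : CompleteSpace (H1 d) := by
  have hi : Isometry (H1.graph (d := d)) :=
    AddMonoidHomClass.isometry_of_norm _ fun _ => rfl
  exact (completeSpace_iff_isComplete_range hi.isUniformInducing).2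
    H1.isClosed_range_graph.isComplete

/-- The state space `H¹ × L²(𝕋^d, ℝ)`, with `‖(w, v)‖² = ‖w‖²_{H¹} + ‖v‖²_{L²}`. -/
abbrev State (d : ℕ) : Type := WithLp 2 (H1 d × L2 d)

/-- The state with profile `w` and velocity `v`. -/
abbrev mkState {d : ℕ} (w : H1 d) (v : L2 d) : State d := WithLp.toLp 2 (w, v)

theorem integral_fourier_eq_zero {n : ℤ} (hn : n ≠ 0) :
    ∫ x : AddCircle (2 * Real.pi), (fourier n x : ℂ) = 0 :=
  integral_eq_zero_of_add_right_eq_neg (fourier_add_half_inv_index hn Real.two_pi_pos)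

theorem integral_conj_eigenfunction_mul {d : ℕ} {j k : Fin d → ℤ} (h : j ≠ k) :
    ∫ x : Torus d, conj (eigenfunction j x) * eigenfunction k x = 0 := by
  obtain ⟨i, hi⟩ := Function.ne_iff.1 h
  have hx : ∀ x : Torus d, conj (eigenfunction j x) * eigenfunction k x =
      (((2 * Real.pi) ^ (-(d : ℝ) / 2) : ℝ) : ℂ) ^ 2 * ∏ l, fourier (k l - j l) (x l) := by
    intro x
    simp only [eigenfunction, ContinuousMap.coe_mk, map_mul, Complex.conj_ofReal, map_prod,
      sub_eq_add_neg, fourier_add, Finset.prod_mul_distrib, fourier_neg]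
    ring
  simp only [hx]
  rw [integral_const_mul, integral_fintype_prod_volume_eq_prod
    (fun l (y : AddCircle (2 * Real.pi)) => (fourier (k l - j l) y : ℂ)),
    Finset.prod_eq_zero (Finset.mem_univ i)
      (integral_fourier_eq_zero (sub_ne_zero.2 (Ne.symm hi))), mul_zero]

theorem conj_eigenfunction {d : ℕ} (k : Fin d → ℤ) (x : Torus d) :
    conj (eigenfunction k x) = eigenfunction (-k) x := by
  simp [eigenfunction]

/-- The real function `Re (a φ_k)`. -/
def mode {d : ℕ} (k : Fin d → ℤ) (a : ℂ) : C(Torus d, ℝ) where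
  toFun x := (a * eigenfunction k x).re
  continuous_toFun :=
    Complex.continuous_re.comp (continuous_const.mul (eigenfunction k).continuous)

/-- The real function `Re (a φ_k)`, as an element of `L²`. -/
def modeL2 {d : ℕ} (k : Fin d → ℤ) (a : ℂ) : L2 d :=
  ContinuousMap.toLp (E := ℝ) 2 volume ℝ (mode k a)

theorem coeff_modeL2_eq_zero {d : ℕ} {j k : Fin d → ℤ} (a : ℂ) (h1 : j ≠ k) (h2 : j ≠ -k) :
    coeff (modeL2 k a) j = 0 := by
  have h : coeff (modeL2 k a) j = ∫ x : Torus d,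
      ((a / 2) * (conj (eigenfunction j x) * eigenfunction k x) +
        (conj a / 2) * (conj (eigenfunction j x) * eigenfunction (-k) x)) := by
    apply integral_congr_ae
    filter_upwards [ContinuousMap.coeFn_toLp (p := 2) (E := ℝ) (𝕜 := ℝ)
      (volume : Measure (Torus d)) (mode k a)] with x hx
    have hr : ((mode k a x : ℝ) : ℂ) =
        (a * eigenfunction k x + conj (a * eigenfunction k x)) / 2 := Complex.re_eq_add_conj _
    rw [modeL2, hx, hr, map_mul, conj_eigenfunction k]
    ring
  have hc : ∀ m : Fin d → ℤ, Integrable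
      (fun x : Torus d => conj (eigenfunction j x) * eigenfunction m x) := fun m =>
    Continuous.integrable_of_hasCompactSupport
      ((Complex.continuous_conj.comp (eigenfunction j).continuous).mul (eigenfunction m).continuous)
      (HasCompactSupport.of_compactSpace _)
  rw [h, integral_add ((hc k).const_mul _) ((hc (-k)).const_mul _), integral_const_mul,
    integral_const_mul, integral_conj_eigenfunction_mul h1, integral_conj_eigenfunction_mul h2]
  simp

/-- The real function `Re (a φ_k)`, as an element of `H¹`. -/
def modeH1 {d : ℕ} (k : Fin d → ℤ) (a : ℂ) : H1 d :=
  ⟨modeL2 k a, summable_of_ne_finset_zero (s := {k, -k}) fun j hj => by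
    simp only [Finset.mem_insert, Finset.mem_singleton, not_or] at hj
    simp [coeff_modeL2_eq_zero a hj.1 hj.2]⟩

/-- The Fourier coefficient at `k` of the profile of `e^{t𝒜} W`. -/
def profileCoeff {d : ℕ} (t : ℝ) (W : State d) (k : Fin d → ℤ) : ℂ :=
  (Real.cos (freq k * t) : ℂ) * coeff W.fst.toL2 k +
    ((if k = 0 then t else Real.sin (freq k * t) / freq k : ℝ) : ℂ) * coeff W.snd k

/-- The Fourier coefficient at `k` of the velocity of `e^{t𝒜} W`. -/
def velocityCoeff {d : ℕ} (t : ℝ) (W : State d) (k : Fin d → ℤ) : ℂ :=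
  ((-(freq k * Real.sin (freq k * t)) : ℝ) : ℂ) * coeff W.fst.toL2 k +
    (Real.cos (freq k * t) : ℂ) * coeff W.snd k

/-- The free evolution `e^{t𝒜}`, `𝒜 = (0, I; Δ, 0)`, through its Fourier series, which converges
in `H¹ × L²`. The sum of the series `∑_k a_k φ_k` of a real function is real, so that each term
may be replaced by its real part. -/
def freeEvolution {d : ℕ} (t : ℝ) (W : State d) : State d :=
  ∑' k : Fin d → ℤ, mkState (modeH1 k (profileCoeff t W k)) (modeL2 k (velocityCoeff t W k))

/-- Indices of the `2d + 1` controls: the constant, the `d` cosines and the `d` sines. -/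
abbrev ControlIndex (d : ℕ) : Type := Unit ⊕ Fin d ⊕ Fin d

/-- The functions `1`, `cos x_i`, `sin x_i` on the torus. -/
def lowMode {d : ℕ} : ControlIndex d → C(Torus d, ℝ)
  | .inl _ => 1
  | .inr (.inl i) => ⟨fun x => (fourier 1 (x i) : ℂ).re, by fun_prop⟩
  | .inr (.inr i) => ⟨fun x => (fourier 1 (x i) : ℂ).im, by fun_prop⟩

theorem fourier_one_coe (y : ℝ) :
    (fourier 1 (y : AddCircle (2 * Real.pi)) : ℂ) = Complex.exp (y * Complex.I) := by
  rw [fourier_coe_apply]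
  congr 1
  have : (Real.pi : ℂ) ≠ 0 := by exact_mod_cast Real.pi_ne_zero
  push_cast
  field_simp

theorem lowMode_cos {d : ℕ} (i : Fin d) (y : Fin d → ℝ) :
    lowMode (.inr (.inl i)) (fun l => (y l : AddCircle (2 * Real.pi))) = Real.cos (y i) := by
  simp only [lowMode, ContinuousMap.coe_mk, fourier_one_coe, Complex.exp_ofReal_mul_I_re]

theorem lowMode_sin {d : ℕ} (i : Fin d) (y : Fin d → ℝ) :
    lowMode (.inr (.inr i)) (fun l => (y l : AddCircle (2 * Real.pi))) = Real.sin (y i) := by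
  simp only [lowMode, ContinuousMap.coe_mk, fourier_one_coe, Complex.exp_ofReal_mul_I_im]

/-- The control function `μ(x) = ∑_j p_j μ_j(x)` at a fixed time. -/
def controlFunction {d : ℕ} (p : ControlIndex d → ℝ) : C(Torus d, ℝ) := ∑ j, p j • lowMode j

/-- The product of a continuous function and an `L²` function, in `L²`. -/
def mulL2 {d : ℕ} (g : C(Torus d, ℝ)) (w : L2 d) : L2 d :=
  MemLp.toLp (fun x => g x * w x)
    ((Lp.memLp w).mul' (p := ∞) (r := 2) (ContinuousMap.memLp _ ℝ g))

/-- The operator `∑_j p_j μ_j ℬ`, `ℬ = (0, 0; I, 0)`: it maps `(w, v)` to `(0, ∑_j p_j μ_j w)`. -/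
def controlOperator {d : ℕ} (p : ControlIndex d → ℝ) (W : State d) : State d :=
  mkState 0 (mulL2 (controlFunction p) W.fst.toL2)

/-- `p` is piecewise constant on `[0, τ]`: there are `0 = t_0 ≤ t_1 ≤ ⋯ ≤ t_n = τ` such that `p`
is constant on each interval `(t_i, t_{i+1})`. -/
def IsPiecewiseConstant {E : Type*} (τ : ℝ) (p : ℝ → E) : Prop :=
  ∃ (n : ℕ) (t : ℕ → ℝ), Monotone t ∧ t 0 = 0 ∧ t n = τ ∧
    ∀ i < n, ∃ c, ∀ s ∈ Ioo (t i) (t (i + 1)), p s = c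

/-- `W` is the weak (mild) solution on `[0, τ]` of `∂_t W = (𝒜 + ∑_j p_j(t) μ_j ℬ) W` with
`W(0) = W₀`, that is, of `∂_t² w = (Δ + ∑_j p_j(t) μ_j) w` with `(w, ∂_t w)(0) = W₀`. -/
def IsSolution {d : ℕ} (τ : ℝ) (p : ℝ → ControlIndex d → ℝ) (W₀ : State d) (W : ℝ → State d) :
    Prop :=
  ContinuousOn W (Icc 0 τ) ∧ ∀ t ∈ Icc 0 τ,
    W t = freeEvolution t W₀ +
      ∫ s in (0 : ℝ)..t, freeEvolution (t - s) (controlOperator (p s) (W s))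

end TorusWave

end

/-! Write `B_f` for the bounded operator `(w, v) ↦ (0, f w)`. It only reads the profile and only
writes the velocity, so `B_f B_g = 0` and `exp(B_f) = I + B_f`. The target state is the kick `I +
B_φ` applied to the initial state, and the kicks available in arbitrarily short time are enlarged
until they approximate it.

A constant control of size `1/τ` acting for time `τ` overwhelms the free evolution. As `τ → 0` the
flow tends to `I + B_f`, for any `f` in the span of the `2d + 1` controlled modes
(`exists_norm_sub_kick_lt`, `kickable_controlFunction`).

New directions come from conjugating the free group `S(t)` by kicks of size `t^{-1/2}`: if `f` maps
`H¹` to `H¹`, then `(I - t^{-1/2} B_f) S(t) (I + t^{-1/2} B_f) x → x - B_{f²} x` as `t → 0+`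
(`tendsto_conj_freeEvolution`). To leading order `S(t)` turns the velocity `t^{-1/2} f w` into a
change `t^{1/2} f w` of the profile, which the second kick converts into the velocity `-f² w`; all
other terms cancel or vanish.

This gives only negative squares, but `cos² + sin² = 1` reverses the sign, because constants can be
kicked with either sign. Polarisation then yields products, and the addition formulas make the set
of attainable frequencies a subgroup of `ℤ^d` that contains the unit vectors, hence all of `ℤ^d`
(`trig_mem_kickSpace`). By Stone–Weierstrass these kicks are uniformly dense in `C(𝕋^d)`.

The hypothesis `w₀φ ∈ L²` says that `φ` lies in `L²(|w₀|² dx)`, where continuous functions are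
dense, so `f w₀` can be made close to `w₀φ` (`exists_norm_mulL2_sub_lt`). For `d ≤ 1` it is
automatic, since functions in `H¹` are continuous. Limits may be chained because each flow depends
continuously on its initial state (`closure_orbit_trans`), and Grönwall's inequality makes the
solution unique. -/

noncomputable section

namespace TorusWave

open Filter Topology

variable {d : ℕ}

/-! ### Fourier series on the torus -/

/-- The exponential monomial `e^{i k·x}`. -/
def monomial (k : Fin d → ℤ) : C(Torus d, ℂ) where
  toFun x := ∏ i, fourier (k i) (x i)
  continuous_toFun := by fun_prop

theorem monomial_apply (k : Fin d → ℤ) (x : Torus d) :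
    monomial k x = ∏ i, (fourier (k i) (x i) : ℂ) := rfl

theorem monomial_add (k l : Fin d → ℤ) (x : Torus d) :
    monomial (k + l) x = monomial k x * monomial l x := by
  simp [monomial_apply, Finset.prod_mul_distrib]

theorem monomial_neg (k : Fin d → ℤ) (x : Torus d) : monomial (-k) x = conj (monomial k x) := by
  simp [monomial_apply, map_prod]

theorem monomial_zero (x : Torus d) : monomial 0 x = 1 := by
  simp [monomial_apply]

theorem norm_monomial_apply (k : Fin d → ℤ) (x : Torus d) : ‖monomial k x‖ = 1 := by
  rw [monomial_apply, norm_prod]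
  exact Finset.prod_eq_one fun i _ => by rw [fourier_apply, Circle.norm_coe]

theorem monomial_single (x : Torus d) (i : Fin d) :
    monomial (Pi.single i 1) x = fourier 1 (x i) := by
  rw [monomial_apply, Finset.prod_eq_single i]
  · simp
  · intro j _ hj
    simp [Pi.single_eq_of_ne hj]
  · simp

theorem eigenfunction_apply (k : Fin d → ℤ) (x : Torus d) :
    eigenfunction k x = (((2 * Real.pi) ^ (-(d : ℝ) / 2) : ℝ) : ℂ) * monomial k x := rfl

/-- The star subalgebra generated by the exponential monomials. -/
def monomialSubalgebra (d : ℕ) : StarSubalgebra ℂ C(Torus d, ℂ) where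
  toSubalgebra := Algebra.adjoin ℂ (range monomial)
  star_mem' := by
    change Algebra.adjoin ℂ (range monomial) ≤ star (Algebra.adjoin ℂ (range monomial))
    refine Algebra.adjoin_le ?_
    rintro _ ⟨n, rfl⟩
    refine Algebra.subset_adjoin ⟨-n, ?_⟩
    ext1 x
    simp only [monomial_neg, starRingEnd_apply, ContinuousMap.star_apply]

theorem monomialSubalgebra_coe : Subalgebra.toSubmodule (monomialSubalgebra d).toSubalgebra =
    Submodule.span ℂ (range monomial) := by
  apply Algebra.adjoin_eq_span_of_subset
  refine .trans (fun x ↦ Submonoid.closure_induction (fun _ ↦ id) ⟨0, ?_⟩ ?_)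
    Submodule.subset_span
  · ext z
    simp [monomial_zero]
  · rintro _ _ _ _ ⟨m, rfl⟩ ⟨n, rfl⟩
    refine ⟨m + n, ?_⟩
    ext z
    simp [monomial_add]

theorem monomialSubalgebra_separatesPoints : (monomialSubalgebra d).SeparatesPoints := by
  intro x y hxy
  obtain ⟨i, hi⟩ := Function.ne_iff.1 hxy
  refine ⟨_, ⟨monomial (Pi.single i 1), Algebra.subset_adjoin ⟨Pi.single i 1, rfl⟩, rfl⟩, ?_⟩
  beta_reduce
  rw [monomial_single, monomial_single, fourier_one, fourier_one]
  exact fun h => hi (AddCircle.injective_toCircle Real.two_pi_pos.ne' (Circle.ext h))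

/-- Stone–Weierstrass: the monomials are closed under products and conjugation, so that their span
is a star subalgebra, and the coordinates `e^{i x_j}` separate points. -/
theorem span_monomial_closure_eq_top :
    (Submodule.span ℂ (range (monomial (d := d)))).topologicalClosure = ⊤ := by
  rw [← monomialSubalgebra_coe]
  exact congr_arg (Subalgebra.toSubmodule <| StarSubalgebra.toSubalgebra ·)
    (ContinuousMap.starSubalgebra_topologicalClosure_eq_top_of_separatesPoints _
      monomialSubalgebra_separatesPoints)

/-- The complex `L²` space of the torus. -/
abbrev ComplexL2 (d : ℕ) : Type := Lp ℂ 2 (volume : Measure (Torus d))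

/-- The eigenfunction `φ_k` as an element of the complex `L²` space. -/
abbrev eigenLp (k : Fin d → ℤ) : ComplexL2 d :=
  ContinuousMap.toLp (E := ℂ) 2 volume ℂ (eigenfunction k)

theorem span_eigenfunction_closure_eq_top :
    (Submodule.span ℂ (range (eigenfunction (d := d)))).topologicalClosure = ⊤ := by
  rw [eq_top_iff, ← span_monomial_closure_eq_top]
  refine Submodule.topologicalClosure_mono (Submodule.span_le.2 ?_)
  rintro _ ⟨k, rfl⟩
  have hc : (((2 * Real.pi) ^ (-(d : ℝ) / 2) : ℝ) : ℂ) ≠ 0 :=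
    Complex.ofReal_ne_zero.2 (Real.rpow_pos_of_pos Real.two_pi_pos _).ne'
  have : monomial k = (((2 * Real.pi) ^ (-(d : ℝ) / 2) : ℝ) : ℂ)⁻¹ • eigenfunction k := by
    ext x
    rw [ContinuousMap.smul_apply, eigenfunction_apply, smul_eq_mul, inv_mul_cancel_left₀ hc]
  rw [this]
  exact Submodule.smul_mem _ _ (Submodule.subset_span ⟨k, rfl⟩)

theorem span_eigenLp_closure_eq_top :
    (Submodule.span ℂ (range (eigenLp (d := d)))).topologicalClosure = ⊤ := by
  simpa only [Submodule.map_span, ContinuousLinearMap.coe_coe, ← range_comp,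
    Function.comp_def] using
    (ContinuousMap.toLp_denseRange ℂ (volume : Measure (Torus d)) ℂ
      (by norm_num : (2 : ℝ≥0∞) ≠ ∞)).topologicalClosure_map_submodule
      span_eigenfunction_closure_eq_top

theorem volume_real_torus : (volume : Measure (Torus d)).real univ = (2 * Real.pi) ^ d := by
  rw [Measure.real, volume_pi, Measure.pi_univ]
  simp [AddCircle.measure_univ, Real.pi_pos.le]

theorem integral_conj_eigenfunction_mul_self (k : Fin d → ℤ) :
    ∫ x : Torus d, conj (eigenfunction k x) * eigenfunction k x = 1 := by
  have h : ∀ x : Torus d, conj (eigenfunction k x) * eigenfunction k x =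
      (((2 * Real.pi) ^ (-(d : ℝ)) : ℝ) : ℂ) := by
    intro x
    rw [← Complex.normSq_eq_conj_mul_self, Complex.normSq_eq_norm_sq, eigenfunction_apply,
      norm_mul, norm_monomial_apply, mul_one, Complex.norm_real, Real.norm_eq_abs, sq_abs,
      ← Real.rpow_natCast, ← Real.rpow_mul Real.two_pi_pos.le]
    congr 2
    push_cast
    ring
  simp only [h]
  rw [integral_const, volume_real_torus, Real.rpow_neg Real.two_pi_pos.le, Real.rpow_natCast]
  have : ((2 * Real.pi) ^ d : ℝ) ≠ 0 := (pow_pos Real.two_pi_pos d).ne'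
  rw [Complex.real_smul, ← Complex.ofReal_mul, mul_inv_cancel₀ this, Complex.ofReal_one]

theorem orthonormal_eigenLp : Orthonormal ℂ (eigenLp (d := d)) := by
  rw [orthonormal_iff_ite]
  intro m n
  simp only [ContinuousMap.inner_toLp]
  have : ∀ x : Torus d, eigenfunction n x * conj (eigenfunction m x) =
    conj (eigenfunction m x) * eigenfunction n x := fun x => mul_comm _ _
  simp only [this]
  split_ifs with h
  · rw [h, integral_conj_eigenfunction_mul_self]
  · exact integral_conj_eigenfunction_mul h

/-- The Hilbert basis of eigenfunctions. -/
def eigenBasis (d : ℕ) : HilbertBasis (Fin d → ℤ) ℂ (ComplexL2 d) :=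
  HilbertBasis.mk orthonormal_eigenLp span_eigenLp_closure_eq_top.ge

theorem eigenBasis_apply (k : Fin d → ℤ) : eigenBasis d k = eigenLp k := by
  rw [eigenBasis, HilbertBasis.coe_mk]

/-- The inclusion of the real in the complex `L²` space. -/
abbrev complexify : L2 d →L[ℝ] ComplexL2 d := Complex.ofRealCLM.compLpL 2 volume

/-- The real part, from the complex to the real `L²` space. -/
abbrev realPart : ComplexL2 d →L[ℝ] L2 d := Complex.reCLM.compLpL 2 volume

theorem complexify_coeFn (w : L2 d) : complexify w =ᵐ[volume] fun x => ((w x : ℝ) : ℂ) :=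
  Complex.ofRealCLM.coeFn_compLpL w

theorem realPart_coeFn (f : ComplexL2 d) : realPart f =ᵐ[volume] fun x => (f x).re :=
  Complex.reCLM.coeFn_compLpL f

theorem norm_complexify (w : L2 d) : ‖complexify w‖ = ‖w‖ := by
  apply le_antisymm
  · refine Lp.norm_le_norm_of_ae_le ?_
    filter_upwards [complexify_coeFn w] with x hx
    simp [hx]
  · refine Lp.norm_le_norm_of_ae_le ?_
    filter_upwards [complexify_coeFn w] with x hx
    simp [hx]

theorem realPart_complexify (w : L2 d) : realPart (complexify w) = w := by
  apply Lp.ext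
  filter_upwards [complexify_coeFn w, realPart_coeFn (complexify w)] with x h1 h2
  simp [h1, h2]

theorem eigenBasis_repr_complexify (w : L2 d) (k : Fin d → ℤ) :
    (eigenBasis d).repr (complexify w) k = coeff w k := by
  rw [HilbertBasis.repr_apply_apply, eigenBasis_apply, coeff_eq_inner]

theorem hasSum_norm_coeff_sq (w : L2 d) :
    HasSum (fun k => ‖coeff w k‖ ^ 2) (‖w‖ ^ 2) := by
  have h := lp.hasSum_norm (p := 2) (by norm_num) ((eigenBasis d).repr (complexify w))
  simp only [ENNReal.toReal_ofNat, Real.rpow_ofNat, LinearIsometryEquiv.norm_map,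
    eigenBasis_repr_complexify, norm_complexify] at h
  exact h

theorem hasSum_coeff_smul_eigenLp (w : L2 d) :
    HasSum (fun k => coeff w k • eigenLp k) (complexify w) := by
  simpa only [eigenBasis_repr_complexify, eigenBasis_apply] using
    (eigenBasis d).hasSum_repr (complexify w)

theorem modeL2_eq_realPart (k : Fin d → ℤ) (a : ℂ) :
    modeL2 k a = realPart (a • eigenLp k) := by
  apply Lp.ext
  filter_upwards [realPart_coeFn (a • eigenLp k), Lp.coeFn_smul a (eigenLp k),
    ContinuousMap.coeFn_toLp (p := 2) (E := ℂ) (𝕜 := ℂ) (volume : Measure (Torus d))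
      (eigenfunction k),
    ContinuousMap.coeFn_toLp (p := 2) (E := ℝ) (𝕜 := ℝ)
      (volume : Measure (Torus d)) (mode k a)] with x h1 h2 h3 h4
  rw [h1, h2, Pi.smul_apply, h3, modeL2, h4]
  rfl

theorem hasSum_modeL2 (w : L2 d) : HasSum (fun k => modeL2 k (coeff w k)) w := by
  have h := (hasSum_coeff_smul_eigenLp w).mapL (realPart (d := d))
  rw [realPart_complexify] at h
  simpa only [modeL2_eq_realPart] using h

theorem ext_coeff {v w : L2 d} (h : ∀ k, coeff v k = coeff w k) : v = w := by
  have h1 := hasSum_modeL2 v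
  simp only [h] at h1
  exact h1.unique (hasSum_modeL2 w)

theorem coeff_neg_index (w : L2 d) (k : Fin d → ℤ) : coeff w (-k) = conj (coeff w k) := by
  rw [coeff, coeff, ← integral_conj]
  simp only [conj_eigenfunction, map_mul, Complex.conj_ofReal, neg_neg]

/-- Conjugating a function conjugates its coefficients and reverses the frequency. -/
theorem coeff_realPart (f : ComplexL2 d) (k : Fin d → ℤ) :
    coeff (realPart f) k = ((eigenBasis d).repr f k + conj ((eigenBasis d).repr f (-k))) / 2 := by
  have hr : ∀ j, (eigenBasis d).repr f j = ∫ x, conj (eigenfunction j x) * f x := by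
    intro j
    rw [HilbertBasis.repr_apply_apply, eigenBasis_apply, L2.inner_def]
    apply integral_congr_ae
    filter_upwards [ContinuousMap.coeFn_toLp (p := 2) (E := ℂ) (𝕜 := ℂ)
      (volume : Measure (Torus d)) (eigenfunction j)] with x hx
    rw [hx, RCLike.inner_apply, mul_comm]
  have hi : ∀ j, Integrable (fun x => conj (eigenfunction j x) * f x) := by
    intro j
    have := L2.integrable_inner (𝕜 := ℂ) (eigenLp j) f
    refine this.congr ?_
    filter_upwards [ContinuousMap.coeFn_toLp (p := 2) (E := ℂ) (𝕜 := ℂ)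
      (volume : Measure (Torus d)) (eigenfunction j)] with x hx
    rw [hx, RCLike.inner_apply, mul_comm]
  rw [hr, hr, ← integral_conj, ← integral_add (hi k), ← integral_div, coeff]
  · apply integral_congr_ae
    filter_upwards [realPart_coeFn f] with x hx
    rw [hx, Complex.re_eq_add_conj, map_mul, ← conj_eigenfunction, Complex.conj_conj]
    ring
  · exact Complex.conjCLE.toContinuousLinearMap.integrable_comp (hi (-k))

theorem repr_smul_eigenLp (k j : Fin d → ℤ) (a : ℂ) :
    (eigenBasis d).repr (a • eigenLp k) j = if j = k then a else 0 := by
  rw [HilbertBasis.repr_apply_apply, eigenBasis_apply, inner_smul_right,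
    orthonormal_iff_ite.1 orthonormal_eigenLp]
  split_ifs <;> simp

/-- `Re (a φ_k)` is half of `a φ_k + conj a φ_{-k}`. A sum of two conditionals is used so that both
halves are counted at `k = 0`. -/
theorem coeff_modeL2 (k j : Fin d → ℤ) (a : ℂ) :
    coeff (modeL2 k a) j = (if j = k then a / 2 else 0) + if j = -k then conj a / 2 else 0 := by
  rw [modeL2_eq_realPart, coeff_realPart, repr_smul_eigenLp, repr_smul_eigenLp]
  simp only [neg_eq_iff_eq_neg]
  split_ifs <;> (try simp only [map_zero]) <;> ring

/-- A square summable family with the symmetry of a real function is the family of Fourier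
coefficients of a real `L²` function. -/
theorem exists_coeff_eq {c : (Fin d → ℤ) → ℂ} (hc : Summable fun k => ‖c k‖ ^ 2)
    (hs : ∀ k, c (-k) = conj (c k)) : ∃ w : L2 d, ∀ k, coeff w k = c k := by
  have hm : Memℓp c 2 := memℓp_gen (by simpa using hc)
  refine ⟨realPart ((eigenBasis d).repr.symm ⟨c, hm⟩), fun k => ?_⟩
  rw [coeff_realPart, LinearIsometryEquiv.apply_symm_apply]
  change (c k + conj (c (-k))) / 2 = c k
  rw [hs, Complex.conj_conj]
  ring

theorem eigenvalue_neg (k : Fin d → ℤ) : eigenvalue (-k) = eigenvalue k := by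
  simp [eigenvalue]

theorem freq_neg (k : Fin d → ℤ) : freq (-k) = freq k := by
  rw [freq, freq, eigenvalue_neg]

theorem freq_nonneg (k : Fin d → ℤ) : 0 ≤ freq k := Real.sqrt_nonneg _

theorem freq_sq (k : Fin d → ℤ) : freq k ^ 2 = eigenvalue k := Real.sq_sqrt (eigenvalue_nonneg k)

theorem freq_zero : freq (0 : Fin d → ℤ) = 0 := by
  simp [freq, eigenvalue]

/-! ### Fourier expansions in `H¹` and in the state space -/

theorem freqSeq_apply (w : H1 d) (k : Fin d → ℤ) :
    H1.freqSeq w k = (freq k : ℂ) * coeff w.toL2 k := rfl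

theorem toL2_modeH1 (k : Fin d → ℤ) (a : ℂ) : (modeH1 k a).toL2 = modeL2 k a := rfl

theorem freqSeq_modeH1 (w : H1 d) (k : Fin d → ℤ) :
    H1.freqSeq (modeH1 k (coeff w.toL2 k)) =
      (1 / 2 : ℝ) • (lp.single 2 k (H1.freqSeq w k) +
        lp.single 2 (-k) (H1.freqSeq w (-k))) := by
  ext j
  rw [freqSeq_apply, toL2_modeH1, coeff_modeL2, lp.coeFn_smul, Pi.smul_apply, lp.coeFn_add,
    Pi.add_apply, lp.single_apply, lp.single_apply, Pi.single_apply, Pi.single_apply,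
    freqSeq_apply, freqSeq_apply, coeff_neg_index]
  rw [Complex.real_smul]
  split_ifs with h1 h2 h2
  · subst h1
    rw [← h2]; push_cast; ring
  · subst h1; push_cast; ring
  · subst h2; push_cast; ring
  · simp

/-- The `H¹` norm is induced by the graph map, so convergence is checked separately in `L²` and in
the weighted sequence space. -/
theorem hasSum_modeH1 (w : H1 d) : HasSum (fun k => modeH1 k (coeff w.toL2 k)) w := by
  have hi : Isometry (H1.graph (d := d)) :=
    AddMonoidHomClass.isometry_of_norm _ fun _ => rfl
  rw [← hi.isUniformInducing.isInducing.hasSum_iff (g := H1.graph (d := d))]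
  have h1 := lp.hasSum_single (p := 2) (by norm_num) (H1.freqSeq w)
  -- Each mode carries half of the entries at `k` and at `-k`; averaging the series with its
  -- reflection recovers the whole sequence.
  have h2 := (Equiv.neg (Fin d → ℤ)).hasSum_iff.2 h1
  have h3 := (h1.add h2).const_smul (1 / 2 : ℝ)
  have h4 : (1 / 2 : ℝ) • (H1.freqSeq w + H1.freqSeq w) = H1.freqSeq w := by
    rw [← two_smul ℝ, smul_smul]
    norm_num
  rw [h4] at h3
  have h5 := (hasSum_modeL2 w.toL2).prodMk h3
  have h6 := h5.mapL (WithLp.prodContinuousLinearEquiv 2 ℝ (L2 d)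
    (lp (fun _ : Fin d → ℤ => ℂ) 2)).symm.toContinuousLinearMap
  convert! h6 using 1
  funext k
  apply WithLp.ofLp_injective
  refine Prod.ext rfl ?_
  exact freqSeq_modeH1 w k

theorem hasSum_modeState (W : State d) :
    HasSum (fun k => mkState (modeH1 k (coeff W.fst.toL2 k)) (modeL2 k (coeff W.snd k))) W := by
  exact ((hasSum_modeH1 W.fst).prodMk (hasSum_modeL2 W.snd)).mapL
    (WithLp.prodContinuousLinearEquiv 2 ℝ (H1 d) (L2 d)).symm.toContinuousLinearMap

theorem H1.ext_coeff {v w : H1 d} (h : ∀ k, coeff v.toL2 k = coeff w.toL2 k) : v = w :=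
  H1.toL2_injective (TorusWave.ext_coeff h)

theorem State.ext_coeff {V W : State d} (h1 : ∀ k, coeff V.fst.toL2 k = coeff W.fst.toL2 k)
    (h2 : ∀ k, coeff V.snd k = coeff W.snd k) : V = W := by
  apply WithLp.ofLp_injective
  exact Prod.ext (H1.ext_coeff h1) (TorusWave.ext_coeff h2)

/-- The contribution of the frequency `k` to the squared norm of a state. -/
def density (W : State d) (k : Fin d → ℤ) : ℝ :=
  (1 + eigenvalue k) * ‖coeff W.fst.toL2 k‖ ^ 2 + ‖coeff W.snd k‖ ^ 2

theorem density_nonneg (W : State d) (k : Fin d → ℤ) : 0 ≤ density W k := by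
  have := eigenvalue_nonneg k
  unfold density
  positivity

theorem H1.hasSum_norm_sq (w : H1 d) :
    HasSum (fun k => (1 + eigenvalue k) * ‖coeff w.toL2 k‖ ^ 2) (‖w‖ ^ 2) := by
  rw [H1.norm_sq]
  simpa only [add_mul, one_mul] using (hasSum_norm_coeff_sq w.toL2).add w.summable.hasSum

theorem hasSum_density (W : State d) : HasSum (density W) (‖W‖ ^ 2) := by
  rw [WithLp.prod_norm_sq_eq_of_L2]
  exact (H1.hasSum_norm_sq W.fst).add (hasSum_norm_coeff_sq W.snd)

theorem exists_H1_coeff_eq {c : (Fin d → ℤ) → ℂ}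
    (hc : Summable fun k => (1 + eigenvalue k) * ‖c k‖ ^ 2)
    (hs : ∀ k, c (-k) = conj (c k)) : ∃ w : H1 d, ∀ k, coeff w.toL2 k = c k := by
  have h1 : Summable fun k => ‖c k‖ ^ 2 := by
    refine hc.of_nonneg_of_le (fun k => by positivity) fun k => ?_
    nlinarith [mul_nonneg (eigenvalue_nonneg k) (sq_nonneg ‖c k‖)]
  obtain ⟨w, hw⟩ := exists_coeff_eq h1 hs
  refine ⟨⟨w, ?_⟩, hw⟩
  refine hc.of_nonneg_of_le (fun k => mul_nonneg (eigenvalue_nonneg k) (sq_nonneg _)) fun k => ?_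
  rw [hw]
  nlinarith [sq_nonneg ‖c k‖]

theorem coeff_sub (v w : L2 d) (k : Fin d → ℤ) : coeff (v - w) k = coeff v k - coeff w k := by
  rw [eq_sub_iff_add_eq, ← coeff_add, sub_add_cancel]

theorem density_sub_le (V W : State d) (k : Fin d → ℤ) :
    density (V - W) k ≤ 2 * (density V k + density W k) := by
  have h : ∀ a b : ℂ, ‖a - b‖ ^ 2 ≤ 2 * (‖a‖ ^ 2 + ‖b‖ ^ 2) := fun a b => by
    have := norm_sub_le a b
    nlinarith [norm_nonneg (a - b), sq_nonneg (‖a‖ - ‖b‖)]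
  simp only [density, WithLp.sub_fst, WithLp.sub_snd, map_sub, coeff_sub]
  have h1 := mul_le_mul_of_nonneg_left (h (coeff V.fst.toL2 k) (coeff W.fst.toL2 k))
    (by linarith [eigenvalue_nonneg k] : 0 ≤ 1 + eigenvalue k)
  linarith [h (coeff V.snd k) (coeff W.snd k)]

/-- Dominated convergence for Fourier coefficients. -/
theorem tendsto_of_coeff {ι : Type*} {l : Filter ι} {Z : ι → State d} {Z₀ : State d}
    {g : (Fin d → ℤ) → ℝ} (hg : Summable g) (hb : ∀ᶠ i in l, ∀ k, density (Z i - Z₀) k ≤ g k)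
    (h1 : ∀ k, Tendsto (fun i => coeff (Z i).fst.toL2 k) l (𝓝 (coeff Z₀.fst.toL2 k)))
    (h2 : ∀ k, Tendsto (fun i => coeff (Z i).snd k) l (𝓝 (coeff Z₀.snd k))) :
    Tendsto Z l (𝓝 Z₀) := by
  have hd : ∀ k, Tendsto (fun i => density (Z i - Z₀) k) l (𝓝 0) := by
    intro k
    have h3 := (((h1 k).sub_const (coeff Z₀.fst.toL2 k)).norm.pow 2).const_mul (1 + eigenvalue k)
    have h4 := ((h2 k).sub_const (coeff Z₀.snd k)).norm.pow 2
    simpa [density, coeff_sub] using h3.add h4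
  have h := tendsto_tsum_of_dominated_convergence (𝓕 := l) (f := fun i k => density (Z i - Z₀) k)
    (g := fun _ => (0 : ℝ)) hg hd (by
      filter_upwards [hb] with i hi k
      rw [Real.norm_of_nonneg (density_nonneg _ _)]
      exact hi k)
  simp only [(hasSum_density _).tsum_eq, tsum_zero] at h
  rw [tendsto_iff_norm_sub_tendsto_zero]
  simpa using h.sqrt

section MildSolutions

/-! ### Piecewise constant functions -/

section PiecewiseConstant

variable {E : Type*} {τ : ℝ} {p : ℝ → E}

theorem isPiecewiseConstant_const (hτ : 0 ≤ τ) (c : E) : IsPiecewiseConstant τ fun _ => c := by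
  refine ⟨1, fun i => if i = 0 then 0 else τ, ?_, by simp, by simp, fun i _ => ⟨c, fun _ _ => rfl⟩⟩
  intro i j hij
  rcases eq_or_ne i 0 with rfl | hi
  · by_cases hj : j = 0 <;> simp [hj, hτ]
  · have hj : j ≠ 0 := by omega
    simp [hi, hj]

theorem IsPiecewiseConstant.comp {F : Type*} (hp : IsPiecewiseConstant τ p) (g : E → F) :
    IsPiecewiseConstant τ fun s => g (p s) := by
  obtain ⟨n, t, hm, h0, hn, hc⟩ := hp
  refine ⟨n, t, hm, h0, hn, fun i hi => ?_⟩
  obtain ⟨c, hc⟩ := hc i hi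
  exact ⟨g c, fun s hs => congrArg g (hc s hs)⟩

theorem IsPiecewiseConstant.concat {τ₁ τ₂ : ℝ} {p₁ p₂ : ℝ → E} (h₁ : IsPiecewiseConstant τ₁ p₁)
    (h₂ : IsPiecewiseConstant τ₂ p₂) :
    IsPiecewiseConstant (τ₁ + τ₂) fun s => if s < τ₁ then p₁ s else p₂ (s - τ₁) := by
  obtain ⟨n, t, hm, h0, hn, hc⟩ := h₁
  obtain ⟨m, u, hm', h0', hn', hc'⟩ := h₂
  have hu : ∀ i, 0 ≤ u i := fun i => h0' ▸ hm' (Nat.zero_le i)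
  -- At the junction `i = n` both branches give `τ₁`, since `t n = τ₁` and `u 0 = 0`.
  refine ⟨n + m, fun i => if i ≤ n then t i else τ₁ + u (i - n), ?_, by simp [h0], ?_, ?_⟩
  · intro i j hij
    by_cases hi : i ≤ n <;> by_cases hj : j ≤ n
    · simpa [hi, hj] using hm hij
    · simp only [hi, hj, if_true, if_false]
      linarith [hm hi, hu (j - n)]
    · omega
    · simpa [hi, hj] using hm' (Nat.sub_le_sub_right hij n)
  · by_cases h : m = 0
    · subst h
      simp [hn, ← hn', h0']
    · simp [h, hn']
  · intro i hi
    by_cases hin : i < n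
    · obtain ⟨c, hc⟩ := hc i hin
      refine ⟨c, fun s hs => ?_⟩
      simp only [hin.le, Nat.succ_le_of_lt hin, if_true] at hs
      have : s < τ₁ := hs.2.trans_le (hn ▸ hm (Nat.succ_le_of_lt hin))
      exact (if_pos this).trans (hc s hs)
    · push Not at hin
      obtain ⟨c, hc⟩ := hc' (i - n) (by omega)
      refine ⟨c, fun s hs => ?_⟩
      have h1 : (if i ≤ n then t i else τ₁ + u (i - n)) = τ₁ + u (i - n) := by
        split_ifs with h
        · obtain rfl : i = n := le_antisymm h hin
          simp [hn, h0']
        · rfl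
      have h2 : ¬ i + 1 ≤ n := by omega
      have h3 : i + 1 - n = i - n + 1 := by omega
      beta_reduce at hs ⊢
      rw [h1, if_neg h2, h3] at hs
      rw [if_neg (by linarith [hs.1, hu (i - n)]), hc _ ⟨by linarith [hs.1], by linarith [hs.2]⟩]

variable [NormedAddCommGroup E]

theorem IsPiecewiseConstant.intervalIntegrable (hp : IsPiecewiseConstant τ p) :
    IntervalIntegrable p volume 0 τ := by
  obtain ⟨n, t, hm, h0, hn, hc⟩ := hp
  rw [← h0, ← hn]
  refine IntervalIntegrable.trans_iterate fun i hi => ?_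
  obtain ⟨c, hc⟩ := hc i hi
  have hle : t i ≤ t (i + 1) := hm (Nat.le_succ i)
  rw [intervalIntegrable_iff_integrableOn_Ioo_of_le hle]
  refine (integrableOn_const (by simp) (by simp) : IntegrableOn (fun _ => c) _ _).congr_fun
    (fun s hs => (hc s hs).symm) measurableSet_Ioo

theorem IsPiecewiseConstant.exists_norm_le (hp : IsPiecewiseConstant τ p) :
    ∃ N, 0 ≤ N ∧ ∀ s ∈ Icc 0 τ, ‖p s‖ ≤ N := by
  obtain ⟨n, t, hm, h0, hn, hc⟩ := hp
  suffices H : ∀ j ≤ n, ∃ N, 0 ≤ N ∧ ∀ s ∈ Icc 0 (t j), ‖p s‖ ≤ N by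
    obtain ⟨N, hN⟩ := H n le_rfl
    exact ⟨N, hn ▸ hN⟩
  intro j
  induction j with
  | zero =>
    intro _
    refine ⟨‖p 0‖, norm_nonneg _, fun s hs => ?_⟩
    rw [h0, Icc_self, mem_singleton_iff] at hs
    rw [hs]
  | succ j ih =>
    intro hj
    obtain ⟨N, hN0, hN⟩ := ih (by omega)
    obtain ⟨c, hc⟩ := hc j (by omega)
    -- Piecewise constancy leaves the values at the breakpoints free, so the value at the new
    -- endpoint enters the bound separately.
    refine ⟨max N (max ‖c‖ ‖p (t (j + 1))‖), le_max_of_le_left hN0, fun s hs => ?_⟩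
    rcases le_or_gt s (t j) with h | h
    · exact (hN s ⟨hs.1, h⟩).trans (le_max_left _ _)
    · rcases hs.2.lt_or_eq with h' | h'
      · rw [hc s ⟨h, h'⟩]
        exact (le_max_left _ _).trans (le_max_right _ _)
      · rw [h']
        exact (le_max_right _ _).trans (le_max_right _ _)

end PiecewiseConstant

/-! ### Mild solutions of bounded perturbations of a strongly continuous group -/

/-- The integral form of Grönwall's inequality. -/
theorem le_mul_exp_of_le_add_integral {u : ℝ → ℝ} {τ a K : ℝ} (hu : ContinuousOn u (Icc 0 τ))
    (h0 : ∀ t ∈ Icc 0 τ, 0 ≤ u t) (hK : 0 ≤ K)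
    (h : ∀ t ∈ Icc 0 τ, u t ≤ a + K * ∫ s in (0 : ℝ)..t, u s) {t : ℝ} (ht : t ∈ Icc 0 τ) :
    u t ≤ a * Real.exp (K * t) := by
  have hτ : 0 ≤ τ := ht.1.trans ht.2
  -- Extending `u` continuously to the line makes its primitive differentiable everywhere.
  set v : ℝ → ℝ := IccExtend hτ ((Icc 0 τ).domRestrict u) with hv
  have hvc : Continuous v := (continuousOn_iff_continuous_domRestrict.1 hu).Icc_extend'
  have hvu : ∀ s ∈ Icc 0 τ, v s = u s := fun s hs => IccExtend_of_mem hτ _ hs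
  have hI : ∀ t ∈ Icc 0 τ, ∫ s in (0 : ℝ)..t, u s = ∫ s in (0 : ℝ)..t, v s := by
    intro t ht
    refine intervalIntegral.integral_congr fun s hs => ?_
    rw [uIcc_of_le ht.1] at hs
    exact (hvu s ⟨hs.1, hs.2.trans ht.2⟩).symm
  have hG : ∀ t, HasDerivAt (fun t => ∫ s in (0 : ℝ)..t, v s) (v t) t := fun t =>
    hvc.integral_hasStrictDerivAt 0 t |>.hasDerivAt
  have hGn : ∀ t ∈ Icc 0 τ, 0 ≤ ∫ s in (0 : ℝ)..t, v s := by
    intro t ht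
    refine intervalIntegral.integral_nonneg ht.1 fun s hs => ?_
    have hs' : s ∈ Icc 0 τ := ⟨hs.1, hs.2.trans ht.2⟩
    rw [hvu s hs']
    exact h0 s hs'
  -- The primitive `G` of `u` satisfies `G' ≤ K G + a` and `G(0) = 0`, so the differential form of
  -- the inequality applies to it.
  have key := norm_le_gronwallBound_of_norm_deriv_right_le
    (f := fun t => ∫ s in (0 : ℝ)..t, v s) (f' := v) (δ := 0) (K := K) (ε := a) (a := 0) (b := τ)
    (fun t _ => (hG t).continuousAt.continuousWithinAt) (fun t _ => (hG t).hasDerivWithinAt)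
    (by simp) (fun t ht => by
      have ht' : t ∈ Icc 0 τ := ⟨ht.1, ht.2.le⟩
      rw [Real.norm_of_nonneg (hGn t ht'), hvu t ht', Real.norm_of_nonneg (h0 t ht'), ← hI t ht']
      linarith [h t ht']) t ht
  rw [Real.norm_of_nonneg (hGn t ht), ← hI t ht, sub_zero] at key
  refine (h t ht).trans ?_
  refine (add_le_add_right (mul_le_mul_of_nonneg_left key hK) a).trans (le_of_eq ?_)
  rcases eq_or_ne K 0 with rfl | hK0
  · simp
  · rw [gronwallBound_of_K_ne_0 hK0]
    field_simp
    ring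

/-- A strongly continuous one-parameter group of operators. -/
structure StrongGroup (X : Type*) [NormedAddCommGroup X] [NormedSpace ℝ X] where
  op : ℝ → X →L[ℝ] X
  op_zero : ∀ x, op 0 x = x
  op_add : ∀ s t x, op (s + t) x = op s (op t x)
  continuous_op : Continuous fun q : ℝ × X => op q.1 q.2
  exists_bound : ∀ T, ∃ M, ∀ t, |t| ≤ T → ‖op t‖ ≤ M

variable {X : Type*} [NormedAddCommGroup X] [NormedSpace ℝ X] (S : StrongGroup X)

/-- Mild solutions on `[0, τ]` of `W' = (A + C(t)) W`, `W(0) = x`, where `A` generates `S`. -/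
def IsMild (τ : ℝ) (C : ℝ → X →L[ℝ] X) (x : X) (W : ℝ → X) : Prop :=
  ContinuousOn W (Icc 0 τ) ∧ ∀ t ∈ Icc 0 τ,
    W t = S.op t x + ∫ s in (0 : ℝ)..t, S.op (t - s) (C s (W s))

variable {S} {τ : ℝ} {C : ℝ → X →L[ℝ] X} {x y : X} {W V : ℝ → X}

/-- The Duhamel integrand is bounded, and measurable by joint continuity of the group and of
operator evaluation. Continuity of `s ↦ C s` is not available. -/
theorem StrongGroup.intervalIntegrable (hC : IsPiecewiseConstant τ C)
    (hW : ContinuousOn W (Icc 0 τ)) (r : ℝ) {a b : ℝ} (ha : a ∈ Icc 0 τ) (hb : b ∈ Icc 0 τ) :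
    IntervalIntegrable (fun s => S.op (r - s) (C s (W s))) volume a b := by
  have hτ : 0 ≤ τ := ha.1.trans ha.2
  suffices H : IntegrableOn (fun s => S.op (r - s) (C s (W s))) (Icc 0 τ) by
    refine (H.mono_set ?_).intervalIntegrable
    exact uIcc_subset_Icc ha hb
  obtain ⟨N, hN0, hN⟩ := hC.exists_norm_le
  obtain ⟨M, hM⟩ := S.exists_bound (|r| + τ)
  obtain ⟨R, hR⟩ := isCompact_Icc.exists_bound_of_continuousOn hW
  have hCm : AEStronglyMeasurable C (volume.restrict (Icc 0 τ)) :=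
    ((intervalIntegrable_iff_integrableOn_Icc_of_le hτ).1 hC.intervalIntegrable).1
  have hWm : AEStronglyMeasurable W (volume.restrict (Icc 0 τ)) :=
    hW.aestronglyMeasurable_of_isCompact isCompact_Icc measurableSet_Icc
  have hCW : AEStronglyMeasurable (fun s => C s (W s)) (volume.restrict (Icc 0 τ)) :=
    (isBoundedBilinearMap_apply (𝕜 := ℝ) (E := X) (F := X)).continuous.comp_aestronglyMeasurable
      (hCm.prodMk hWm)
  have hm : AEStronglyMeasurable (fun s => S.op (r - s) (C s (W s)))
      (volume.restrict (Icc 0 τ)) :=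
    S.continuous_op.comp_aestronglyMeasurable
      ((continuous_const.sub continuous_id).aestronglyMeasurable.prodMk hCW)
  refine Integrable.of_bound hm (M * (N * R)) ?_
  filter_upwards [ae_restrict_mem measurableSet_Icc] with s hs
  have h1 : |r - s| ≤ |r| + τ := by
    refine (abs_sub _ _).trans ?_
    rw [abs_of_nonneg hs.1]
    linarith [hs.2]
  have h2 := hM _ h1
  have h3 : ‖C s (W s)‖ ≤ N * R := (C s).le_of_opNorm_le_of_le (hN s hs) (hR s hs)
  exact (S.op (r - s)).le_of_opNorm_le_of_le h2 h3

theorem IsMild.apply_zero (hτ : 0 ≤ τ) (hW : IsMild S τ C x W) : W 0 = x := by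
  rw [hW.2 0 ⟨le_rfl, hτ⟩, intervalIntegral.integral_same, add_zero, S.op_zero]

/-- Mild solutions depend Lipschitz continuously on their initial states. -/
theorem exists_norm_sub_le (hτ : 0 ≤ τ) (hC : IsPiecewiseConstant τ C) :
    ∃ L, 0 ≤ L ∧ ∀ x y W V, IsMild S τ C x W → IsMild S τ C y V → ‖W τ - V τ‖ ≤ L * ‖x - y‖ := by
  obtain ⟨N, hN0, hN⟩ := hC.exists_norm_le
  obtain ⟨M, hM⟩ := S.exists_bound τ
  have hM0 : 0 ≤ M := (norm_nonneg _).trans (hM 0 (by simpa using hτ))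
  refine ⟨M * Real.exp (M * N * τ), by positivity, fun x y W V hW hV => ?_⟩
  have hc : ContinuousOn (fun t => ‖W t - V t‖) (Icc 0 τ) := (hW.1.sub hV.1).norm
  have := le_mul_exp_of_le_add_integral (a := M * ‖x - y‖) (K := M * N) hc
    (fun _ _ => norm_nonneg _) (by positivity) (fun t ht => ?_) (right_mem_Icc.2 hτ)
  · linarith [this]
  have h0 : (0 : ℝ) ∈ Icc 0 τ := ⟨le_rfl, hτ⟩
  rw [hW.2 t ht, hV.2 t ht, add_sub_add_comm, ← map_sub, ← intervalIntegral.integral_sub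
    (StrongGroup.intervalIntegrable hC hW.1 t h0 ht) (StrongGroup.intervalIntegrable hC hV.1 t h0 ht),
    ← intervalIntegral.integral_const_mul]
  refine (norm_add_le _ _).trans (add_le_add ?_ ?_)
  · exact (S.op t).le_of_opNorm_le (hM t (by rw [abs_of_nonneg ht.1]; exact ht.2)) _
  · refine intervalIntegral.norm_integral_le_of_norm_le ht.1 ?_ ?_
    · refine ae_of_all _ fun s hs => ?_
      have hs' : s ∈ Icc 0 τ := ⟨hs.1.le, hs.2.trans ht.2⟩
      rw [← map_sub, ← map_sub, mul_assoc]
      refine (S.op (t - s)).le_of_opNorm_le_of_le (hM _ ?_) ((C s).le_of_opNorm_le (hN s hs') _)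
      rw [abs_of_nonneg (by linarith [hs.2])]
      linarith [hs.1, ht.2]
    · refine ((hc.mono ?_).const_mul (M * N)).intervalIntegrable
      rw [uIcc_of_le ht.1]
      exact Icc_subset_Icc_right ht.2

theorem IsMild.unique (hτ : 0 ≤ τ) (hC : IsPiecewiseConstant τ C) (hW : IsMild S τ C x W)
    (hV : IsMild S τ C x V) : W τ = V τ := by
  obtain ⟨L, -, hL⟩ := exists_norm_sub_le (S := S) hτ hC
  have := hL x x W V hW hV
  rw [sub_self, norm_zero, mul_zero] at this
  exact sub_eq_zero.1 (norm_le_zero_iff.1 this)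

variable [CompleteSpace X]

/-- After `τ₁` the Duhamel integral splits at `τ₁`; the group law pulls `S(t - τ₁)` out of the first
piece, which together with the free term is `S(t - τ₁) W(τ₁)`. -/
theorem IsMild.concat {τ₁ τ₂ : ℝ} {C₁ C₂ : ℝ → X →L[ℝ] X} (hτ₁ : 0 ≤ τ₁) (hτ₂ : 0 ≤ τ₂)
    (hC₁ : IsPiecewiseConstant τ₁ C₁)
    (hW : IsMild S τ₁ C₁ x W) (hC₂ : IsPiecewiseConstant τ₂ C₂) (hV : IsMild S τ₂ C₂ (W τ₁) V) :
    IsMild S (τ₁ + τ₂) (fun s => if s < τ₁ then C₁ s else C₂ (s - τ₁)) x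
      (fun t => if t ≤ τ₁ then W t else V (t - τ₁)) := by
  have hV0 := hV.apply_zero hτ₂
  have hU₂ : ∀ t, τ₁ ≤ t → (if t ≤ τ₁ then W t else V (t - τ₁)) = V (t - τ₁) := by
    intro t ht
    split_ifs with h
    · obtain rfl : t = τ₁ := le_antisymm h ht
      rw [sub_self, hV0]
    · rfl
  have hU : ContinuousOn (fun t => if t ≤ τ₁ then W t else V (t - τ₁)) (Icc 0 (τ₁ + τ₂)) := by
    rw [← Icc_union_Icc_eq_Icc hτ₁ (by linarith : τ₁ ≤ τ₁ + τ₂)]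
    refine ContinuousOn.union_of_isClosed ?_ ?_ isClosed_Icc isClosed_Icc
    · exact hW.1.congr fun t ht => if_pos ht.2
    · refine (hV.1.comp (continuous_id.sub continuous_const).continuousOn ?_).congr
        fun t ht => hU₂ t ht.1
      exact fun t ht => ⟨by simpa using ht.1, by simpa [add_comm] using ht.2⟩
  refine ⟨hU, fun t ht => ?_⟩
  have hC := hC₁.concat hC₂
  have hfst : ∀ r : ℝ, ∀ t ∈ Icc 0 τ₁, ∫ s in (0 : ℝ)..t, S.op (r - s)
      ((if s < τ₁ then C₁ s else C₂ (s - τ₁)) (if s ≤ τ₁ then W s else V (s - τ₁))) =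
      ∫ s in (0 : ℝ)..t, S.op (r - s) (C₁ s (W s)) := by
    intro r t ht
    refine intervalIntegral.integral_congr_ae ?_
    -- The control switches at `s < τ₁` but the trajectory at `s ≤ τ₁`; the discrepancy is the
    -- single point `τ₁`.
    filter_upwards [Measure.ae_ne volume τ₁] with s hs hst
    rw [uIoc_of_le ht.1] at hst
    have : s < τ₁ := lt_of_le_of_ne (hst.2.trans ht.2) hs
    rw [if_pos this, if_pos this.le]
  rcases le_total t τ₁ with h | h
  · beta_reduce
    rw [if_pos h, hfst t t ⟨ht.1, h⟩]
    exact hW.2 t ⟨ht.1, h⟩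
  · have h0 : (0 : ℝ) ∈ Icc 0 (τ₁ + τ₂) := ⟨le_rfl, by linarith⟩
    have h1 : τ₁ ∈ Icc 0 (τ₁ + τ₂) := ⟨hτ₁, by linarith⟩
    have h2 : t - τ₁ ∈ Icc 0 τ₂ := ⟨by linarith, by linarith [ht.2]⟩
    beta_reduce
    rw [hU₂ t h, ← intervalIntegral.integral_add_adjacent_intervals
      (StrongGroup.intervalIntegrable hC hU t h0 h1) (StrongGroup.intervalIntegrable hC hU t h1 ht),
      hfst t τ₁ ⟨hτ₁, le_rfl⟩, hV.2 _ h2, hW.2 τ₁ ⟨hτ₁, le_rfl⟩, map_add, ← S.op_add,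
      sub_add_cancel, ← ContinuousLinearMap.intervalIntegral_comp_comm _
      (StrongGroup.intervalIntegrable hC₁ hW.1 τ₁ ⟨le_rfl, hτ₁⟩ ⟨hτ₁, le_rfl⟩), add_assoc]
    congr 2
    · refine intervalIntegral.integral_congr fun s _ => ?_
      rw [← S.op_add, sub_add_sub_cancel]
    · have := intervalIntegral.integral_comp_sub_right (a := τ₁) (b := t)
        (fun s => S.op (t - τ₁ - s) (C₂ s (V s))) τ₁
      rw [sub_self] at this
      rw [← this]
      refine intervalIntegral.integral_congr fun s hs => ?_
      rw [uIcc_of_le h] at hs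
      rw [hU₂ s hs.1, if_neg (not_lt.2 hs.1), sub_sub_sub_cancel_right]

/-- Mild solutions exist for small constant perturbations. -/
theorem exists_isMild_const (hτ : 0 ≤ τ) {M : ℝ} (hM : ∀ t, |t| ≤ τ → ‖S.op t‖ ≤ M)
    (B : X →L[ℝ] X) (hB : M * ‖B‖ * τ ≤ 1 / 2) (x : X) :
    ∃ W, IsMild S τ (fun _ => B) x W := by
  have hM0 : 0 ≤ M := (norm_nonneg _).trans (hM 0 (by simpa using hτ))
  have hcont : ∀ w : C(Icc 0 τ, X), Continuous fun s => S.op (-s) (B (IccExtend hτ w s)) :=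
    fun w => S.continuous_op.comp
      (continuous_neg.prodMk (B.continuous.comp w.continuous.Icc_extend'))
  -- The Picard map. Factoring `S(t)` out of the Duhamel integral leaves a primitive, so joint
  -- continuity of the group gives continuity in `t`.
  let T : C(Icc 0 τ, X) → C(Icc 0 τ, X) := fun w =>
    ⟨fun t => S.op t (x + ∫ s in (0 : ℝ)..t, S.op (-s) (B (IccExtend hτ w s))),
      S.continuous_op.comp (continuous_subtype_val.prodMk (continuous_const.add
        ((intervalIntegral.continuous_primitive
          (fun a b => (hcont w).intervalIntegrable a b) 0).comp continuous_subtype_val)))⟩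
  have hTapp : ∀ w (t : Icc 0 τ), T w t =
      S.op t x + ∫ s in (0 : ℝ)..t, S.op (t - s) (B (IccExtend hτ w s)) := by
    intro w t
    change S.op t (x + ∫ s in (0 : ℝ)..t, S.op (-s) (B (IccExtend hτ w s))) = _
    rw [map_add, ← ContinuousLinearMap.intervalIntegral_comp_comm _
      ((hcont w).intervalIntegrable _ _)]
    simp only [← S.op_add, ← sub_eq_add_neg]
  have hcont' : ∀ (w : C(Icc 0 τ, X)) (t : ℝ),
      Continuous fun s => S.op (t - s) (B (IccExtend hτ w s)) :=
    fun w t => S.continuous_op.comp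
      ((continuous_const.sub continuous_id).prodMk (B.continuous.comp w.continuous.Icc_extend'))
  have hT : ContractingWith (1 / 2) T := by
    refine ⟨by norm_num, LipschitzWith.of_dist_le_mul fun w w' => ?_⟩
    rw [ContinuousMap.dist_le (by positivity)]
    intro t
    rw [hTapp, hTapp, dist_eq_norm, add_sub_add_left_eq_sub, ← intervalIntegral.integral_sub
      ((hcont' w t).intervalIntegrable _ _) ((hcont' w' t).intervalIntegrable _ _)]
    have hb : ∀ s ∈ uIoc (0 : ℝ) t, ‖S.op (t - s) (B (IccExtend hτ w s)) -
        S.op (t - s) (B (IccExtend hτ w' s))‖ ≤ M * (‖B‖ * dist w w') := by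
      intro s hs
      rw [uIoc_of_le t.2.1] at hs
      rw [← map_sub, ← map_sub]
      refine (S.op (t - s)).le_of_opNorm_le_of_le (hM _ ?_) (B.le_of_opNorm_le_of_le le_rfl ?_)
      · rw [abs_of_nonneg (by linarith [hs.2])]
        linarith [hs.1, t.2.2]
      · rw [← dist_eq_norm]
        exact ContinuousMap.dist_apply_le_dist _
    refine (intervalIntegral.norm_integral_le_of_norm_le_const hb).trans ?_
    rw [sub_zero, abs_of_nonneg t.2.1]
    calc M * (‖B‖ * dist w w') * t ≤ M * (‖B‖ * dist w w') * τ := by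
          gcongr
          exact t.2.2
      _ = M * ‖B‖ * τ * dist w w' := by ring
      _ ≤ 1 / 2 * dist w w' := by gcongr
      _ = _ := by simp
  have : Nonempty C(Icc 0 τ, X) := ⟨0⟩
  have hfix := hT.fixedPoint_isFixedPt
  set w := ContractingWith.fixedPoint T hT
  refine ⟨IccExtend hτ w, w.continuous.Icc_extend'.continuousOn, fun t ht => ?_⟩
  have h := hTapp w ⟨t, ht⟩
  rw [hfix.eq] at h
  rw [IccExtend_of_mem hτ _ ht]
  exact h

/-- A strong control acting for a short time produces a jump `x ↦ x + B x`, if `B² = 0`. -/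
theorem exists_norm_sub_kick_lt (B : X →L[ℝ] X) (hB : ∀ x, B (B x) = 0) (x : X) {ε : ℝ}
    (hε : 0 < ε) : ∃ δ > 0, ∀ τ, 0 < τ → τ < δ → ∀ W, IsMild S τ (fun _ => τ⁻¹ • B) x W →
      ‖W τ - (x + B x)‖ < ε := by
  obtain ⟨M, hM⟩ := S.exists_bound 1
  have hM0 : 0 ≤ M := (norm_nonneg _).trans (hM 0 (by simp))
  -- With the control `τ⁻¹ B`, the Grönwall factor at time `τ` is `exp (M ‖B‖)`, independent of `τ`.
  obtain ⟨η, hη0, hη⟩ : ∃ η > 0, 2 * η * Real.exp (M * ‖B‖) < ε := by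
    refine ⟨ε / (4 * Real.exp (M * ‖B‖)), by positivity, ?_⟩
    field_simp
    linarith
  have hlim : ∀ z, ∀ᶠ r in 𝓝 (0 : ℝ), ‖S.op r z - z‖ < η := by
    intro z
    have h : Continuous fun r => S.op r z :=
      S.continuous_op.comp (continuous_id.prodMk continuous_const)
    have h2 := Metric.tendsto_nhds.1 (h.tendsto 0) η hη0
    simpa only [S.op_zero, dist_eq_norm] using h2
  obtain ⟨δ, hδ0, hδ⟩ := Metric.eventually_nhds_iff.1 ((hlim x).and (hlim (B x)))
  refine ⟨min δ 1, by positivity, fun τ hτ0 hτ W hW => ?_⟩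
  have hτδ := hτ.trans_le (min_le_left _ _)
  have hτ1 := hτ.trans_le (min_le_right _ _)
  have hsmall : ∀ r, 0 ≤ r → r ≤ τ → ‖S.op r x - x‖ < η ∧ ‖S.op r (B x) - B x‖ < η := by
    intro r h0 h1
    refine hδ ?_
    rw [dist_zero_right, Real.norm_of_nonneg h0]
    linarith
  -- The comparison path is the solution without free evolution, affine in time because `B² = 0`.
  have hc : ContinuousOn (fun t => ‖W t - (x + (t / τ) • B x)‖) (Icc 0 τ) :=
    (hW.1.sub (by fun_prop)).norm
  have key := le_mul_exp_of_le_add_integral (a := 2 * η) (K := M * ‖B‖ / τ) hc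
    (fun _ _ => norm_nonneg _) (by positivity) (fun t ht => ?_) (right_mem_Icc.2 hτ0.le)
  · rw [div_self hτ0.ne', one_smul, div_mul_cancel₀ _ hτ0.ne'] at key
    exact key.trans_lt hη
  have h0 : (0 : ℝ) ∈ Icc 0 τ := ⟨le_rfl, hτ0.le⟩
  have hI : ContinuousOn (fun s => ‖W s - (x + (s / τ) • B x)‖) (uIcc 0 t) := by
    rw [uIcc_of_le ht.1]
    exact hc.mono (Icc_subset_Icc_right ht.2)
  have h1 : W t - (x + (t / τ) • B x) = (S.op t x - x) +
      ∫ s in (0 : ℝ)..t, (S.op (t - s) ((τ⁻¹ • B) (W s)) - τ⁻¹ • B x) := by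
    rw [intervalIntegral.integral_sub (StrongGroup.intervalIntegrable
      (isPiecewiseConstant_const hτ0.le _) hW.1 t h0 ht) intervalIntegrable_const,
      intervalIntegral.integral_const, hW.2 t ht, smul_smul, sub_zero, div_eq_mul_inv]
    abel
  rw [h1]
  -- One `η` pays for `S(t)x - x`, the other for `S(t - s)Bx - Bx` weighted by `1/τ` over a time at
  -- most `τ`.
  have h2 : 2 * η + M * ‖B‖ / τ * ∫ s in (0 : ℝ)..t, ‖W s - (x + (s / τ) • B x)‖ ≥
      η + ∫ s in (0 : ℝ)..t, (η / τ + M * ‖B‖ / τ * ‖W s - (x + (s / τ) • B x)‖) := by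
    rw [intervalIntegral.integral_add intervalIntegrable_const
      (hI.const_mul _).intervalIntegrable, intervalIntegral.integral_const_mul,
      intervalIntegral.integral_const, sub_zero, smul_eq_mul]
    have : t * (η / τ) ≤ η := by
      rw [mul_div_assoc', div_le_iff₀ hτ0, mul_comm]
      exact mul_le_mul_of_nonneg_left ht.2 hη0.le
    linarith
  refine le_trans (norm_add_le _ _) (le_trans (add_le_add (hsmall t ht.1 ht.2).1.le ?_) h2)
  refine intervalIntegral.norm_integral_le_of_norm_le ht.1 (ae_of_all _ fun s hs => ?_)
    (intervalIntegrable_const.add (hI.const_mul _).intervalIntegrable)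
  -- Since `B² = 0`, subtracting the comparison path from `W s` removes exactly `B x` from `B (W
  -- s)`.
  have h3 : S.op (t - s) ((τ⁻¹ • B) (W s)) - τ⁻¹ • B x =
      τ⁻¹ • ((S.op (t - s) (B x) - B x) + S.op (t - s) (B (W s - (x + (s / τ) • B x)))) := by
    rw [map_sub, map_add, map_smul, hB, smul_zero, add_zero, map_sub,
      _root_.smul_apply, map_smul, ← smul_sub]
    congr 1
    abel
  rw [h3, norm_smul, Real.norm_of_nonneg (inv_nonneg.2 hτ0.le)]
  have h4 := (hsmall (t - s) (by linarith [hs.2]) (by linarith [hs.1, ht.2])).2.le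
  have h5 : ‖S.op (t - s) (B (W s - (x + (s / τ) • B x)))‖ ≤
      M * (‖B‖ * ‖W s - (x + (s / τ) • B x)‖) := by
    refine (S.op (t - s)).le_of_opNorm_le_of_le (hM _ ?_) (B.le_opNorm _)
    rw [abs_of_nonneg (by linarith [hs.2])]
    linarith [hs.1, ht.2]
  calc _ ≤ τ⁻¹ * (η + M * (‖B‖ * ‖W s - (x + (s / τ) • B x)‖)) := by
        gcongr
        exact (norm_add_le _ _).trans (add_le_add h4 h5)
    _ = _ := by ring

end MildSolutions

/-! ### The free wave group -/

theorem fst_mkState (w : H1 d) (v : L2 d) : (mkState w v).fst = w := rfl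

theorem snd_mkState (w : H1 d) (v : L2 d) : (mkState w v).snd = v := rfl

theorem coeff_zero (k : Fin d → ℤ) : coeff (0 : L2 d) k = 0 := by
  simp [coeff_eq_inner]

/-- The multiplier `sin (t √λ_k) / √λ_k`. -/
def sincCoeff (t : ℝ) (k : Fin d → ℤ) : ℝ := if k = 0 then t else Real.sin (freq k * t) / freq k

theorem freq_pos {k : Fin d → ℤ} (hk : k ≠ 0) : 0 < freq k := by
  obtain ⟨i, hi⟩ := Function.ne_iff.1 hk
  refine Real.sqrt_pos.2 (Finset.sum_pos' (fun _ _ => sq_nonneg _) ⟨i, Finset.mem_univ i, ?_⟩)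
  have : (k i : ℝ) ≠ 0 := by exact_mod_cast hi
  positivity

theorem freq_mul_sincCoeff (t : ℝ) (k : Fin d → ℤ) :
    freq k * sincCoeff t k = Real.sin (freq k * t) := by
  by_cases hk : k = 0
  · simp [hk, freq_zero]
  · rw [sincCoeff, if_neg hk, mul_div_cancel₀ _ (freq_pos hk).ne']

theorem abs_sincCoeff_le (t : ℝ) (k : Fin d → ℤ) : |sincCoeff t k| ≤ |t| := by
  by_cases hk : k = 0
  · simp [sincCoeff, hk]
  · rw [sincCoeff, if_neg hk, abs_div, abs_of_pos (freq_pos hk), div_le_iff₀ (freq_pos hk)]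
    refine Real.abs_sin_le_abs.trans ?_
    rw [abs_mul, abs_of_pos (freq_pos hk), mul_comm]

theorem sincCoeff_sq_le (t : ℝ) (k : Fin d → ℤ) : sincCoeff t k ^ 2 ≤ t ^ 2 :=
  sq_le_sq.2 (abs_sincCoeff_le t k)

theorem sincCoeff_neg (t : ℝ) (k : Fin d → ℤ) : sincCoeff t (-k) = sincCoeff t k := by
  simp [sincCoeff, freq_neg]

theorem sincCoeff_zero (k : Fin d → ℤ) : sincCoeff 0 k = 0 := by
  simp [sincCoeff]

theorem sincCoeff_add (s t : ℝ) (k : Fin d → ℤ) : sincCoeff (s + t) k =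
    Real.cos (freq k * s) * sincCoeff t k + sincCoeff s k * Real.cos (freq k * t) := by
  by_cases hk : k = 0
  · simp [sincCoeff, hk, freq_zero, add_comm]
  · simp only [sincCoeff, if_neg hk, mul_add, Real.sin_add]
    ring

theorem hasDerivAt_sincCoeff (t : ℝ) (k : Fin d → ℤ) :
    HasDerivAt (fun t => sincCoeff t k) (Real.cos (freq k * t)) t := by
  by_cases hk : k = 0
  · simpa [sincCoeff, hk, freq_zero] using hasDerivAt_id' t
  · simp only [sincCoeff, if_neg hk]
    have h := (((hasDerivAt_id t).const_mul (freq k)).sin).div_const (freq k)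
    have hf := (freq_pos hk).ne'
    convert! h using 1
    simp only [id]
    field_simp

theorem profileCoeff_eq (t : ℝ) (W : State d) (k : Fin d → ℤ) : profileCoeff t W k =
    (Real.cos (freq k * t) : ℂ) * coeff W.fst.toL2 k + (sincCoeff t k : ℂ) * coeff W.snd k := rfl

theorem profileCoeff_neg (t : ℝ) (W : State d) (k : Fin d → ℤ) :
    profileCoeff t W (-k) = conj (profileCoeff t W k) := by
  simp [profileCoeff_eq, coeff_neg_index, freq_neg, sincCoeff_neg, -Complex.ofReal_cos]

theorem velocityCoeff_neg (t : ℝ) (W : State d) (k : Fin d → ℤ) :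
    velocityCoeff t W (-k) = conj (velocityCoeff t W k) := by
  simp [velocityCoeff, coeff_neg_index, freq_neg, -Complex.ofReal_cos, -Complex.ofReal_sin]

theorem norm_combination_sq_le (a b : ℝ) (x y : ℂ) :
    ‖(a : ℂ) * x + (b : ℂ) * y‖ ^ 2 ≤ 2 * (a ^ 2 * ‖x‖ ^ 2 + b ^ 2 * ‖y‖ ^ 2) := by
  have h := norm_add_le ((a : ℂ) * x) ((b : ℂ) * y)
  simp only [norm_mul, Complex.norm_real, Real.norm_eq_abs] at h
  have h1 : ‖(a : ℂ) * x + (b : ℂ) * y‖ ^ 2 ≤ (|a| * ‖x‖ + |b| * ‖y‖) ^ 2 :=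
    pow_le_pow_left₀ (norm_nonneg _) h 2
  refine h1.trans ?_
  nlinarith [sq_nonneg (|a| * ‖x‖ - |b| * ‖y‖), sq_abs a, sq_abs b]

/-- The weight `λ_k` is absorbed by `λ_k sinc² = sin²` and `cos² + sin² = 1`. The growth in `t`
comes only from the unweighted `L²` part of the profile, through `sinc² ≤ t²`. -/
theorem coeff_density_le (t : ℝ) (W : State d) (k : Fin d → ℤ) :
    (1 + eigenvalue k) * ‖profileCoeff t W k‖ ^ 2 + ‖velocityCoeff t W k‖ ^ 2 ≤
      (2 + 2 * t ^ 2) * density W k := by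
  have h1 := norm_combination_sq_le (Real.cos (freq k * t)) (sincCoeff t k)
    (coeff W.fst.toL2 k) (coeff W.snd k)
  have h2 := norm_combination_sq_le (-(freq k * Real.sin (freq k * t))) (Real.cos (freq k * t))
    (coeff W.fst.toL2 k) (coeff W.snd k)
  have h3 := Real.sin_sq_add_cos_sq (freq k * t)
  have h4 : eigenvalue k * sincCoeff t k ^ 2 = Real.sin (freq k * t) ^ 2 := by
    rw [← freq_mul_sincCoeff, mul_pow, freq_sq]
  have h5 := sincCoeff_sq_le t k
  have h6 := eigenvalue_nonneg k
  have h7 : (freq k * Real.sin (freq k * t)) ^ 2 =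
      eigenvalue k * Real.sin (freq k * t) ^ 2 := by rw [mul_pow, freq_sq]
  rw [← profileCoeff_eq] at h1
  rw [neg_sq, h7] at h2
  change ‖velocityCoeff t W k‖ ^ 2 ≤ _ at h2
  unfold density
  set c := ‖coeff W.fst.toL2 k‖ ^ 2
  set e := ‖coeff W.snd k‖ ^ 2
  have hc : 0 ≤ c := sq_nonneg _
  have he : 0 ≤ e := sq_nonneg _
  set C := Real.cos (freq k * t) ^ 2
  set s := Real.sin (freq k * t) ^ 2
  have hs : 0 ≤ s := sq_nonneg _
  calc _ ≤ (1 + eigenvalue k) * (2 * (C * c + sincCoeff t k ^ 2 * e)) +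
        2 * (eigenvalue k * s * c + C * e) := by gcongr
    _ = 2 * C * c + 2 * sincCoeff t k ^ 2 * e + 2 * eigenvalue k * (s + C) * c +
        2 * (eigenvalue k * sincCoeff t k ^ 2 + C) * e := by ring
    _ = 2 * C * c + 2 * sincCoeff t k ^ 2 * e + 2 * eigenvalue k * c + 2 * e := by
        rw [h4, h3]; ring
    _ ≤ 2 * 1 * c + 2 * t ^ 2 * e + 2 * eigenvalue k * c + 2 * e := by
        gcongr
        linarith
    _ ≤ _ := by
        have : 0 ≤ 2 * t ^ 2 * ((1 + eigenvalue k) * c) := by positivity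
        linarith

theorem exists_freeState (t : ℝ) (W : State d) : ∃ Z : State d,
    (∀ k, coeff Z.fst.toL2 k = profileCoeff t W k) ∧ ∀ k, coeff Z.snd k = velocityCoeff t W k := by
  have hs := (hasSum_density W).summable.mul_left (2 + 2 * t ^ 2)
  have h1 : Summable fun k => (1 + eigenvalue k) * ‖profileCoeff t W k‖ ^ 2 := by
    refine hs.of_nonneg_of_le (fun k => ?_) fun k => ?_
    · have := eigenvalue_nonneg k
      positivity
    · linarith [coeff_density_le t W k, sq_nonneg ‖velocityCoeff t W k‖]
  have h2 : Summable fun k => ‖velocityCoeff t W k‖ ^ 2 := by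
    refine hs.of_nonneg_of_le (fun k => by positivity) fun k => ?_
    have : 0 ≤ (1 + eigenvalue k) * ‖profileCoeff t W k‖ ^ 2 := by
      have := eigenvalue_nonneg k
      positivity
    linarith [coeff_density_le t W k]
  obtain ⟨u, hu⟩ := exists_H1_coeff_eq h1 (profileCoeff_neg t W)
  obtain ⟨v, hv⟩ := exists_coeff_eq h2 (velocityCoeff_neg t W)
  exact ⟨mkState u v, hu, hv⟩

/-- The series defining `freeEvolution` is the mode expansion of the state given by
`exists_freeState`. Hence it converges, and its `tsum` is not the default value `0`. -/
theorem freeEvolution_spec (t : ℝ) (W : State d) :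
    (∀ k, coeff (freeEvolution t W).fst.toL2 k = profileCoeff t W k) ∧
      ∀ k, coeff (freeEvolution t W).snd k = velocityCoeff t W k := by
  obtain ⟨Z, h1, h2⟩ := exists_freeState t W
  have h := hasSum_modeState Z
  simp only [h1, h2] at h
  rw [freeEvolution, h.tsum_eq]
  exact ⟨h1, h2⟩

theorem coeff_freeEvolution_fst (t : ℝ) (W : State d) (k : Fin d → ℤ) :
    coeff (freeEvolution t W).fst.toL2 k = (Real.cos (freq k * t) : ℂ) * coeff W.fst.toL2 k +
      (sincCoeff t k : ℂ) * coeff W.snd k := (freeEvolution_spec t W).1 k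

theorem coeff_freeEvolution_snd (t : ℝ) (W : State d) (k : Fin d → ℤ) :
    coeff (freeEvolution t W).snd k =
      ((-(freq k * Real.sin (freq k * t)) : ℝ) : ℂ) * coeff W.fst.toL2 k +
        (Real.cos (freq k * t) : ℂ) * coeff W.snd k := (freeEvolution_spec t W).2 k

theorem density_freeEvolution_le (t : ℝ) (W : State d) (k : Fin d → ℤ) :
    density (freeEvolution t W) k ≤ (2 + 2 * t ^ 2) * density W k := by
  rw [density, (freeEvolution_spec t W).1, (freeEvolution_spec t W).2]
  exact coeff_density_le t W k

theorem norm_freeEvolution_le (t : ℝ) (W : State d) :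
    ‖freeEvolution t W‖ ≤ (2 + 2 * |t|) * ‖W‖ := by
  have h := hasSum_le (density_freeEvolution_le t W) (hasSum_density _)
    ((hasSum_density W).mul_left (2 + 2 * t ^ 2))
  refine le_of_sq_le_sq (h.trans ?_) (by positivity)
  rw [mul_pow]
  gcongr
  nlinarith [sq_abs t, abs_nonneg t]

/-- The free evolution as a bounded operator. -/
def freeOp (t : ℝ) : State d →L[ℝ] State d :=
  LinearMap.mkContinuous
    { toFun := freeEvolution t
      map_add' := fun V W => by
        apply State.ext_coeff <;> intro k
        · simp only [WithLp.add_fst, map_add, coeff_add, coeff_freeEvolution_fst, WithLp.add_snd]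
          ring
        · simp only [WithLp.add_snd, WithLp.add_fst, map_add, coeff_add, coeff_freeEvolution_snd]
          ring
      map_smul' := fun c W => by
        apply State.ext_coeff <;> intro k
        · simp only [WithLp.smul_fst, map_smul, coeff_smul, coeff_freeEvolution_fst,
            WithLp.smul_snd, RingHom.id_apply]
          ring
        · simp only [WithLp.smul_snd, WithLp.smul_fst, map_smul, coeff_smul,
            coeff_freeEvolution_snd, RingHom.id_apply]
          ring }
    (2 + 2 * |t|) (norm_freeEvolution_le t)

theorem freeOp_apply (t : ℝ) (W : State d) : freeOp t W = freeEvolution t W := rfl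

theorem norm_freeOp_le (t : ℝ) : ‖freeOp (d := d) t‖ ≤ 2 + 2 * |t| :=
  LinearMap.mkContinuous_norm_le _ (by positivity) _

/-- Each coefficient is continuous in `t`, and for `|t| ≤ |t₀| + 1` the densities are dominated by a
fixed multiple of that of `W`. -/
theorem continuous_freeEvolution (W : State d) : Continuous fun t => freeEvolution t W := by
  rw [continuous_iff_continuousAt]
  intro t₀
  set R : ℝ := (|t₀| + 1) ^ 2
  refine tendsto_of_coeff (g := fun k => 2 * ((2 + 2 * R) * density W k +
    (2 + 2 * R) * density W k)) ?_ ?_ (fun k => ?_) fun k => ?_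
  · have := (hasSum_density W).summable.mul_left (2 + 2 * R)
    exact (this.add this).mul_left 2
  · filter_upwards [Metric.ball_mem_nhds t₀ one_pos] with t ht k
    have hb : ∀ s : ℝ, |s| ≤ |t₀| + 1 →
        density (freeEvolution s W) k ≤ (2 + 2 * R) * density W k := by
      intro s hs
      refine (density_freeEvolution_le s W k).trans ?_
      have := density_nonneg W k
      have h2 : s ^ 2 ≤ R := by
        rw [← sq_abs]
        exact pow_le_pow_left₀ (abs_nonneg _) hs 2
      gcongr
    refine (density_sub_le _ _ k).trans ?_
    have h1 := hb t (by
      rw [Metric.mem_ball, Real.dist_eq] at ht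
      linarith [abs_sub_abs_le_abs_sub t t₀])
    have h2 := hb t₀ (by linarith)
    gcongr
  · simp only [coeff_freeEvolution_fst]
    have hc : Continuous fun t => sincCoeff t k :=
      continuous_iff_continuousAt.2 fun t => (hasDerivAt_sincCoeff t k).continuousAt
    have : Continuous fun t : ℝ => (Real.cos (freq k * t) : ℂ) * coeff W.fst.toL2 k +
      (sincCoeff t k : ℂ) * coeff W.snd k := by fun_prop
    exact this.tendsto t₀
  · simp only [coeff_freeEvolution_snd]
    have : Continuous fun t : ℝ => ((-(freq k * Real.sin (freq k * t)) : ℝ) : ℂ) *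
      coeff W.fst.toL2 k + (Real.cos (freq k * t) : ℂ) * coeff W.snd k := by fun_prop
    exact this.tendsto t₀

theorem freeEvolution_zero (W : State d) : freeEvolution 0 W = W := by
  apply State.ext_coeff <;> intro k
  · simp [coeff_freeEvolution_fst, sincCoeff_zero]
  · simp [coeff_freeEvolution_snd]

theorem freeEvolution_add (s t : ℝ) (W : State d) :
    freeEvolution (s + t) W = freeEvolution s (freeEvolution t W) := by
  apply State.ext_coeff <;> intro k
  · simp only [coeff_freeEvolution_fst, coeff_freeEvolution_snd, sincCoeff_add, mul_add,
      Real.cos_add]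
    rw [← freq_mul_sincCoeff s k]
    push_cast
    ring
  · simp only [coeff_freeEvolution_fst, coeff_freeEvolution_snd, mul_add,
      Real.cos_add, Real.sin_add]
    have h := freq_mul_sincCoeff t k
    have h1 : (freq k : ℂ) * (Real.sin (freq k * s) : ℂ) * (sincCoeff t k : ℂ) =
        (Real.sin (freq k * s) : ℂ) * (Real.sin (freq k * t) : ℂ) := by
      rw [← h]
      push_cast
      ring
    push_cast at h1 ⊢
    linear_combination coeff W.snd k * h1

/-- The strongly continuous group of the free wave equation. -/
def waveGroup (d : ℕ) : StrongGroup (State d) where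
  op := freeOp
  op_zero := freeEvolution_zero
  op_add := freeEvolution_add
  continuous_op := by
    rw [continuous_iff_continuousAt]
    rintro ⟨t₀, W₀⟩
    rw [ContinuousAt, tendsto_iff_norm_sub_tendsto_zero]
    -- Strong continuity and the locally uniform operator bound give joint continuity.
    have h1 : Tendsto (fun q : ℝ × State d => (2 + 2 * |q.1|) * ‖q.2 - W₀‖ +
        ‖freeEvolution q.1 W₀ - freeEvolution t₀ W₀‖) (𝓝 (t₀, W₀)) (𝓝 0) := by
      have hc := continuous_freeEvolution W₀
      have : Continuous fun q : ℝ × State d => (2 + 2 * |q.1|) * ‖q.2 - W₀‖ +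
        ‖freeEvolution q.1 W₀ - freeEvolution t₀ W₀‖ := by fun_prop
      simpa using this.tendsto (t₀, W₀)
    refine squeeze_zero (fun _ => norm_nonneg _) (fun q => ?_) h1
    have : freeOp q.1 q.2 - freeOp t₀ W₀ = freeOp q.1 (q.2 - W₀) +
        (freeEvolution q.1 W₀ - freeEvolution t₀ W₀) := by
      simp only [map_sub, freeOp_apply]
      abel
    rw [this]
    exact (norm_add_le _ _).trans (add_le_add_left (norm_freeEvolution_le _ _) _)
  exists_bound T := ⟨2 + 2 * T, fun t ht => (norm_freeOp_le t).trans (by linarith)⟩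

theorem abs_cos_sub_one_le (x : ℝ) : |Real.cos x - 1| ≤ |x| := by
  simpa using Real.abs_cos_sub_cos_le x 0

/-- From `|cos (|k| t) - 1| ≤ |k| |t|`: the lost factor `|k|` is paid by the `H¹` norm, so the rate
is linear in `L²`. This rate beats the factor `t^{-1/2}` in `tendsto_conj_freeEvolution`. -/
theorem norm_freeEvolution_fst_sub_le (t : ℝ) (W : State d) :
    ‖(freeEvolution t W).fst.toL2 - W.fst.toL2‖ ≤ 2 * |t| * ‖W‖ := by
  have h := hasSum_le (fun k => ?_) (hasSum_norm_coeff_sq ((freeEvolution t W).fst.toL2 - W.fst.toL2))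
    ((hasSum_density W).mul_left (2 * t ^ 2))
  · refine le_of_sq_le_sq (h.trans ?_) (by positivity)
    rw [mul_pow, mul_pow, sq_abs]
    gcongr
    norm_num
  have h1 : coeff ((freeEvolution t W).fst.toL2 - W.fst.toL2) k =
      ((Real.cos (freq k * t) - 1 : ℝ) : ℂ) * coeff W.fst.toL2 k +
        (sincCoeff t k : ℂ) * coeff W.snd k := by
    rw [coeff_sub, coeff_freeEvolution_fst]
    push_cast
    ring
  rw [h1]
  refine (norm_combination_sq_le _ _ _ _).trans ?_
  have h2 : (Real.cos (freq k * t) - 1) ^ 2 ≤ eigenvalue k * t ^ 2 := by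
    rw [← freq_sq, ← mul_pow]
    exact sq_le_sq.2 (abs_cos_sub_one_le _)
  have h3 := sincCoeff_sq_le t k
  have h4 : 0 ≤ t ^ 2 * ‖coeff W.fst.toL2 k‖ ^ 2 := by positivity
  calc _ ≤ 2 * (eigenvalue k * t ^ 2 * ‖coeff W.fst.toL2 k‖ ^ 2 +
        t ^ 2 * ‖coeff W.snd k‖ ^ 2) := by gcongr
    _ ≤ _ := by
      rw [density]
      linarith

/-- A state with profile `0` and velocity in `H¹` is in the domain of the generator. -/
theorem tendsto_freeEvolution_slope (u : H1 d) :
    Tendsto (fun t : ℝ => t⁻¹ • (freeEvolution t (mkState 0 u.toL2) - mkState 0 u.toL2))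
      (𝓝[>] 0) (𝓝 (mkState u 0)) := by
  have hf : ∀ t k, coeff (t⁻¹ • (freeEvolution t (mkState 0 u.toL2) - mkState 0 u.toL2)).fst.toL2 k =
      ((t⁻¹ * sincCoeff t k : ℝ) : ℂ) * coeff u.toL2 k := by
    intro t k
    simp only [WithLp.smul_fst, WithLp.sub_fst, map_smul, map_sub, coeff_smul, coeff_sub,
      coeff_freeEvolution_fst, fst_mkState, snd_mkState, map_zero, coeff_zero]
    push_cast
    ring
  have hv : ∀ t k, coeff (t⁻¹ • (freeEvolution t (mkState 0 u.toL2) - mkState 0 u.toL2)).snd k =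
      ((t⁻¹ * (Real.cos (freq k * t) - 1) : ℝ) : ℂ) * coeff u.toL2 k := by
    intro t k
    simp only [WithLp.smul_snd, WithLp.sub_snd, coeff_smul, coeff_sub,
      coeff_freeEvolution_snd, fst_mkState, snd_mkState, map_zero, coeff_zero]
    push_cast
    ring
  -- The constant is `4 + 1`: the profile multiplier differs from its limit by at most `2`, and the
  -- velocity multiplier is at most `|k|`.
  refine tendsto_of_coeff (g := fun k => 5 * ((1 + eigenvalue k) * ‖coeff u.toL2 k‖ ^ 2))
    ((H1.hasSum_norm_sq u).summable.mul_left 5) ?_ (fun k => ?_) fun k => ?_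
  · filter_upwards [self_mem_nhdsWithin] with t ht k
    have ht0 : (0 : ℝ) < t := ht
    have h1 : |t⁻¹ * sincCoeff t k - 1| ≤ 2 := by
      have : |t⁻¹ * sincCoeff t k| ≤ 1 := by
        rw [abs_mul, abs_inv, inv_mul_le_iff₀ (abs_pos.2 ht0.ne'), mul_one]
        exact abs_sincCoeff_le t k
      have h2 := abs_sub (t⁻¹ * sincCoeff t k) 1
      rw [abs_one] at h2
      linarith
    have h2 : |t⁻¹ * (Real.cos (freq k * t) - 1)| ≤ freq k := by
      rw [abs_mul, abs_inv, inv_mul_le_iff₀ (abs_pos.2 ht0.ne')]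
      refine (abs_cos_sub_one_le _).trans ?_
      rw [abs_mul, abs_of_nonneg (freq_nonneg k), mul_comm]
    have h3 := pow_le_pow_left₀ (abs_nonneg _) h1 2
    have h4 := pow_le_pow_left₀ (abs_nonneg _) h2 2
    rw [freq_sq] at h4
    simp only [density, WithLp.sub_fst, WithLp.sub_snd, map_sub, coeff_sub, hf, hv,
      fst_mkState, snd_mkState, sub_zero]
    have h5 : ((t⁻¹ * sincCoeff t k : ℝ) : ℂ) * coeff u.toL2 k - coeff u.toL2 k =
        ((t⁻¹ * sincCoeff t k - 1 : ℝ) : ℂ) * coeff u.toL2 k := by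
      push_cast
      ring
    rw [h5, norm_mul, norm_mul, Complex.norm_real, Complex.norm_real, mul_pow, mul_pow,
      Real.norm_eq_abs, Real.norm_eq_abs]
    have h6 := eigenvalue_nonneg k
    calc _ ≤ (1 + eigenvalue k) * (2 ^ 2 * ‖coeff u.toL2 k‖ ^ 2) +
          eigenvalue k * ‖coeff u.toL2 k‖ ^ 2 := by gcongr
      _ ≤ _ := by nlinarith [sq_nonneg ‖coeff u.toL2 k‖]
  · simp only [hf, fst_mkState]
    have h := (hasDerivAt_sincCoeff 0 k).tendsto_slope_zero_right
    simp only [zero_add, sincCoeff_zero, sub_zero, mul_zero, Real.cos_zero, smul_eq_mul] at h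
    simpa using ((Complex.continuous_ofReal.tendsto _).comp h).mul_const (coeff u.toL2 k)
  · simp only [hv, snd_mkState, coeff_zero]
    have h := ((((hasDerivAt_id (0 : ℝ)).const_mul (freq k)).cos)).tendsto_slope_zero_right
    simp only [zero_add, id, mul_zero, Real.cos_zero, Real.sin_zero, neg_zero, zero_mul,
      smul_eq_mul] at h
    simpa using ((Complex.continuous_ofReal.tendsto _).comp h).mul_const (coeff u.toL2 k)

/-! ### Multiplication operators and kicks -/

theorem mulL2_coeFn (g : C(Torus d, ℝ)) (w : L2 d) :
    mulL2 g w =ᵐ[volume] fun x => g x * w x := MemLp.coeFn_toLp _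

theorem mulL2_add_right (g : C(Torus d, ℝ)) (v w : L2 d) :
    mulL2 g (v + w) = mulL2 g v + mulL2 g w := by
  apply Lp.ext
  filter_upwards [mulL2_coeFn g (v + w), mulL2_coeFn g v, mulL2_coeFn g w, Lp.coeFn_add v w,
    Lp.coeFn_add (mulL2 g v) (mulL2 g w)] with x h1 h2 h3 h4 h5
  rw [h1, h5, Pi.add_apply, h2, h3, h4, Pi.add_apply, mul_add]

theorem mulL2_smul_right (g : C(Torus d, ℝ)) (c : ℝ) (w : L2 d) :
    mulL2 g (c • w) = c • mulL2 g w := by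
  apply Lp.ext
  filter_upwards [mulL2_coeFn g (c • w), mulL2_coeFn g w, Lp.coeFn_smul c w,
    Lp.coeFn_smul c (mulL2 g w)] with x h1 h2 h3 h4
  rw [h1, h4, Pi.smul_apply, h2, h3, Pi.smul_apply, smul_eq_mul, smul_eq_mul, mul_left_comm]

theorem mulL2_add_left (f g : C(Torus d, ℝ)) (w : L2 d) :
    mulL2 (f + g) w = mulL2 f w + mulL2 g w := by
  apply Lp.ext
  filter_upwards [mulL2_coeFn (f + g) w, mulL2_coeFn f w, mulL2_coeFn g w,
    Lp.coeFn_add (mulL2 f w) (mulL2 g w)] with x h1 h2 h3 h4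
  rw [h1, h4, Pi.add_apply, h2, h3, ContinuousMap.add_apply, add_mul]

theorem mulL2_smul_left (c : ℝ) (g : C(Torus d, ℝ)) (w : L2 d) :
    mulL2 (c • g) w = c • mulL2 g w := by
  apply Lp.ext
  filter_upwards [mulL2_coeFn (c • g) w, mulL2_coeFn g w,
    Lp.coeFn_smul c (mulL2 g w)] with x h1 h2 h3
  rw [h1, h3, Pi.smul_apply, h2, ContinuousMap.smul_apply, smul_eq_mul, smul_eq_mul, mul_assoc]

theorem mulL2_mul (f g : C(Torus d, ℝ)) (w : L2 d) :
    mulL2 (f * g) w = mulL2 f (mulL2 g w) := by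
  apply Lp.ext
  filter_upwards [mulL2_coeFn (f * g) w, mulL2_coeFn g w,
    mulL2_coeFn f (mulL2 g w)] with x h1 h2 h3
  rw [h1, h3, h2, ContinuousMap.mul_apply, mul_assoc]

theorem norm_mulL2_le (g : C(Torus d, ℝ)) (w : L2 d) : ‖mulL2 g w‖ ≤ ‖g‖ * ‖w‖ := by
  refine Lp.norm_le_mul_norm_of_ae_le_mul ?_
  filter_upwards [mulL2_coeFn g w] with x h
  rw [h, norm_mul]
  gcongr
  exact g.norm_coe_le_norm x

theorem H1.norm_toL2_le (w : H1 d) : ‖w.toL2‖ ≤ ‖w‖ := by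
  refine le_of_sq_le_sq ?_ (norm_nonneg _)
  rw [H1.norm_sq]
  have : 0 ≤ ∑' k, eigenvalue k * ‖coeff w.toL2 k‖ ^ 2 :=
    tsum_nonneg fun k => mul_nonneg (eigenvalue_nonneg k) (sq_nonneg _)
  linarith

theorem norm_mkState_zero (v : L2 d) : ‖mkState 0 v‖ = ‖v‖ := by
  have h := WithLp.prod_norm_sq_eq_of_L2 (mkState 0 v)
  rw [fst_mkState, snd_mkState, norm_zero, zero_pow two_ne_zero, zero_add] at h
  exact (sq_eq_sq₀ (norm_nonneg _) (norm_nonneg _)).1 h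

theorem norm_fst_le (W : State d) : ‖W.fst‖ ≤ ‖W‖ := by
  refine le_of_sq_le_sq ?_ (norm_nonneg _)
  rw [WithLp.prod_norm_sq_eq_of_L2]
  linarith [sq_nonneg ‖W.snd‖]

/-- The bounded operator `(w, v) ↦ (0, f w)`. -/
def potentialOp (f : C(Torus d, ℝ)) : State d →L[ℝ] State d :=
  LinearMap.mkContinuous
    { toFun := fun W => mkState 0 (mulL2 f W.fst.toL2)
      map_add' := fun V W => by
        rw [WithLp.add_fst, map_add, mulL2_add_right, ← WithLp.toLp_add, Prod.mk_add_mk, add_zero]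
      map_smul' := fun c W => by
        rw [WithLp.smul_fst, map_smul, mulL2_smul_right, ← WithLp.toLp_smul, Prod.smul_mk,
          smul_zero, RingHom.id_apply] }
    ‖f‖ fun W => by
      change ‖mkState 0 (mulL2 f W.fst.toL2)‖ ≤ _
      rw [norm_mkState_zero]
      refine (norm_mulL2_le _ _).trans ?_
      gcongr
      exact (H1.norm_toL2_le _).trans (norm_fst_le _)

theorem potentialOp_apply (f : C(Torus d, ℝ)) (W : State d) :
    potentialOp f W = mkState 0 (mulL2 f W.fst.toL2) := rfl

theorem norm_potentialOp_apply_le (f : C(Torus d, ℝ)) (W : State d) :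
    ‖potentialOp f W‖ ≤ ‖f‖ * ‖W.fst.toL2‖ := by
  rw [potentialOp_apply, norm_mkState_zero]
  exact norm_mulL2_le _ _

theorem norm_potentialOp_le (f : C(Torus d, ℝ)) : ‖potentialOp f‖ ≤ ‖f‖ :=
  LinearMap.mkContinuous_norm_le _ (norm_nonneg _) _

theorem potentialOp_add (f g : C(Torus d, ℝ)) :
    potentialOp (f + g) = potentialOp f + potentialOp g := by
  ext1 W
  rw [_root_.add_apply, potentialOp_apply, potentialOp_apply, potentialOp_apply,
    mulL2_add_left, ← WithLp.toLp_add, Prod.mk_add_mk, add_zero]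

theorem potentialOp_smul (c : ℝ) (f : C(Torus d, ℝ)) :
    potentialOp (c • f) = c • potentialOp f := by
  ext1 W
  rw [_root_.smul_apply, potentialOp_apply, potentialOp_apply, mulL2_smul_left,
    ← WithLp.toLp_smul, Prod.smul_mk, smul_zero]

theorem potentialOp_zero : potentialOp (0 : C(Torus d, ℝ)) = 0 := by
  have h := potentialOp_add (0 : C(Torus d, ℝ)) 0
  rwa [add_zero, left_eq_add] at h

theorem potentialOp_neg (f : C(Torus d, ℝ)) : potentialOp (-f) = -potentialOp f := by
  rw [eq_neg_iff_add_eq_zero, ← potentialOp_add, neg_add_cancel, potentialOp_zero]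

theorem potentialOp_potentialOp (f g : C(Torus d, ℝ)) (W : State d) :
    potentialOp f (potentialOp g W) = 0 := by
  have h : mulL2 f (0 : L2 d) = 0 := by simpa using mulL2_smul_right f 0 0
  rw [potentialOp_apply, potentialOp_apply, fst_mkState, map_zero, h]
  rfl

/-- Both sides unfold to the same formula; this transfers the abstract theory of mild solutions to
the wave equation. -/
theorem isSolution_iff {τ : ℝ} {p : ℝ → ControlIndex d → ℝ} {W₀ : State d} {W : ℝ → State d} :
    IsSolution τ p W₀ W ↔
      IsMild (waveGroup d) τ (fun s => potentialOp (controlFunction (p s))) W₀ W := Iff.rfl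

theorem controlFunction_smul (c : ℝ) (q : ControlIndex d → ℝ) :
    controlFunction (c • q) = c • controlFunction q := by
  simp only [controlFunction, Finset.smul_sum, Pi.smul_apply, smul_eq_mul, mul_smul]

theorem controlFunction_single (j : ControlIndex d) (c : ℝ) :
    controlFunction (Pi.single j c) = c • lowMode j := by
  rw [controlFunction, Finset.sum_eq_single j]
  · rw [Pi.single_eq_same]
  · intro i _ hi
    rw [Pi.single_eq_of_ne hi, zero_smul]
  · simp

/-! ### Trigonometric functions as multipliers of `H¹` -/

/-- The real part of a continuous function. -/
def reMap (g : C(Torus d, ℂ)) : C(Torus d, ℝ) := ⟨fun x => (g x).re, by fun_prop⟩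

theorem reMap_apply (g : C(Torus d, ℂ)) (x : Torus d) : reMap g x = (g x).re := rfl

/-- The trigonometric function `Re (a e^{i k·x})`. -/
def trig (k : Fin d → ℤ) (a : ℂ) : C(Torus d, ℝ) := reMap (a • monomial k)

theorem trig_apply (k : Fin d → ℤ) (a : ℂ) (x : Torus d) :
    trig k a x = (a * monomial k x).re := rfl

theorem conj_eigenfunction_mul_monomial (k l : Fin d → ℤ) (x : Torus d) :
    conj (eigenfunction k x) * monomial l x = conj (eigenfunction (k - l) x) := by
  rw [conj_eigenfunction, conj_eigenfunction, eigenfunction_apply, eigenfunction_apply, mul_assoc,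
    ← monomial_add, neg_sub, neg_add_eq_sub]

theorem integrable_conj_eigenfunction_mul (w : L2 d) (k : Fin d → ℤ) :
    Integrable fun x => conj (eigenfunction k x) * ((w x : ℝ) : ℂ) := by
  have h := L2.integrable_inner (𝕜 := ℂ) (eigenLp k) (complexify w)
  refine h.congr ?_
  filter_upwards [ContinuousMap.coeFn_toLp (p := 2) (E := ℂ) (𝕜 := ℂ)
    (volume : Measure (Torus d)) (eigenfunction k), complexify_coeFn w] with x h1 h2
  rw [h1, h2, RCLike.inner_apply, mul_comm]

/-- Multiplication by `e^{± i l·x}` shifts frequencies by `± l`. -/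
theorem coeff_mulL2_trig (l : Fin d → ℤ) (a : ℂ) (w : L2 d) (k : Fin d → ℤ) :
    coeff (mulL2 (trig l a) w) k = a / 2 * coeff w (k - l) + conj a / 2 * coeff w (k + l) := by
  simp only [coeff]
  rw [← integral_const_mul, ← integral_const_mul,
    ← integral_add ((integrable_conj_eigenfunction_mul w _).const_mul _)
      ((integrable_conj_eigenfunction_mul w _).const_mul _)]
  apply integral_congr_ae
  filter_upwards [mulL2_coeFn (trig l a) w] with x hx
  rw [hx, trig_apply, Complex.ofReal_mul, Complex.re_eq_add_conj, map_mul, ← monomial_neg,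
    ← conj_eigenfunction_mul_monomial k l, ← sub_neg_eq_add k l,
    ← conj_eigenfunction_mul_monomial k (-l)]
  ring

/-- Multiplication by `g` preserves `H¹`. -/
def IsMultiplier (g : C(Torus d, ℝ)) : Prop := ∀ w : H1 d, mulL2 g w.toL2 ∈ h1Submodule d

theorem IsMultiplier.exists_H1 {g : C(Torus d, ℝ)} (hg : IsMultiplier g) (w : H1 d) :
    ∃ u : H1 d, u.toL2 = mulL2 g w.toL2 := ⟨⟨_, hg w⟩, rfl⟩

theorem IsMultiplier.add {f g : C(Torus d, ℝ)} (hf : IsMultiplier f) (hg : IsMultiplier g) :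
    IsMultiplier (f + g) := fun w => by
  rw [mulL2_add_left]
  exact add_mem (hf w) (hg w)

theorem IsMultiplier.smul {g : C(Torus d, ℝ)} (hg : IsMultiplier g) (c : ℝ) :
    IsMultiplier (c • g) := fun w => by
  rw [mulL2_smul_left]
  exact Submodule.smul_mem _ _ (hg w)

theorem IsMultiplier.mul {f g : C(Torus d, ℝ)} (hf : IsMultiplier f) (hg : IsMultiplier g) :
    IsMultiplier (f * g) := fun w => by
  rw [mulL2_mul]
  exact hf ⟨_, hg w⟩

theorem eigenvalue_add_le (k l : Fin d → ℤ) :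
    eigenvalue (k + l) ≤ 2 * eigenvalue k + 2 * eigenvalue l := by
  simp only [eigenvalue, Finset.mul_sum, ← Finset.sum_add_distrib]
  refine Finset.sum_le_sum fun i _ => ?_
  rw [Pi.add_apply, Int.cast_add]
  nlinarith [sq_nonneg ((k i : ℝ) - l i)]

/-- A shift changes the weight by little: `λ_k ≤ 2 λ_{k+l} + 2 λ_l`. -/
theorem summable_eigenvalue_mul_shift (w : H1 d) (l : Fin d → ℤ) :
    Summable fun k => eigenvalue k * ‖coeff w.toL2 (k + l)‖ ^ 2 := by
  have h := (w.summable.mul_left 2).add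
    ((hasSum_norm_coeff_sq w.toL2).summable.mul_left (2 * eigenvalue l))
  refine ((Equiv.addRight l).summable_iff.2 h).of_nonneg_of_le
    (fun k => mul_nonneg (eigenvalue_nonneg k) (sq_nonneg _)) fun k => ?_
  have h1 := eigenvalue_add_le (k + l) (-l)
  rw [add_neg_cancel_right, eigenvalue_neg] at h1
  have h2 := mul_le_mul_of_nonneg_right h1 (sq_nonneg ‖coeff w.toL2 (k + l)‖)
  simp only [Function.comp_apply, Equiv.coe_addRight]
  linarith

theorem isMultiplier_trig (l : Fin d → ℤ) (a : ℂ) : IsMultiplier (trig l a) := by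
  intro w
  have h := ((summable_eigenvalue_mul_shift w (-l)).add
    (summable_eigenvalue_mul_shift w l)).mul_left (‖a‖ ^ 2 / 2)
  refine h.of_nonneg_of_le (fun k => mul_nonneg (eigenvalue_nonneg k) (sq_nonneg _)) fun k => ?_
  rw [coeff_mulL2_trig, ← sub_eq_add_neg]
  have h1 := norm_add_le (a / 2 * coeff w.toL2 (k - l)) (conj a / 2 * coeff w.toL2 (k + l))
  simp only [norm_mul, norm_div, Complex.norm_conj, Complex.norm_ofNat] at h1
  set x := ‖coeff w.toL2 (k - l)‖
  set y := ‖coeff w.toL2 (k + l)‖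
  have h2 := pow_le_pow_left₀ (norm_nonneg _) h1 2
  have h3 := mul_le_mul_of_nonneg_left h2 (eigenvalue_nonneg k)
  refine h3.trans ?_
  have h4 : (‖a‖ / 2 * x + ‖a‖ / 2 * y) ^ 2 ≤ ‖a‖ ^ 2 / 2 * (x ^ 2 + y ^ 2) := by
    nlinarith [mul_nonneg (sq_nonneg ‖a‖) (sq_nonneg (x - y))]
  have h5 := mul_le_mul_of_nonneg_left h4 (eigenvalue_nonneg k)
  linarith

/-! ### Small-time approximate attainability -/

/-- The flow at time `τ` of some piecewise constant control is `F`. -/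
def Attainable (τ : ℝ) (F : State d → State d) : Prop :=
  0 ≤ τ ∧ Continuous F ∧ ∃ p : ℝ → ControlIndex d → ℝ, IsPiecewiseConstant τ p ∧
    ∀ x, ∃ W, IsSolution τ p x W ∧ W τ = F x

/-- Solvability from every initial state suffices: Grönwall's inequality makes the flow Lipschitz.
-/
theorem exists_attainable {τ : ℝ} (hτ : 0 ≤ τ) {p : ℝ → ControlIndex d → ℝ}
    (hp : IsPiecewiseConstant τ p) (h : ∀ x, ∃ W, IsSolution τ p x W) :
    ∃ F : State d → State d, Attainable τ F ∧ ∀ x, ∃ W, IsSolution τ p x W ∧ W τ = F x := by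
  choose W hW using h
  obtain ⟨L, hL0, hL⟩ := exists_norm_sub_le (S := waveGroup d) hτ
    (hp.comp fun q => potentialOp (controlFunction q))
  have hc : Continuous fun x => W x τ := by
    refine (LipschitzWith.of_dist_le_mul (K := ⟨L, hL0⟩) fun x y => ?_).continuous
    rw [dist_eq_norm, dist_eq_norm]
    exact hL x y _ _ (hW x) (hW y)
  exact ⟨fun x => W x τ, ⟨hτ, hc, p, hp, fun x => ⟨W x, hW x, rfl⟩⟩, fun x => ⟨W x, hW x, rfl⟩⟩

theorem Attainable.comp {τ₁ τ₂ : ℝ} {F G : State d → State d} (hF : Attainable τ₁ F)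
    (hG : Attainable τ₂ G) : Attainable (τ₁ + τ₂) fun x => G (F x) := by
  obtain ⟨h1, hF, p, hp, hW⟩ := hF
  obtain ⟨h2, hG, q, hq, hV⟩ := hG
  refine ⟨add_nonneg h1 h2, hG.comp hF, _, hp.concat hq, fun x => ?_⟩
  obtain ⟨W, hW, hWF⟩ := hW x
  obtain ⟨V, hV, hVG⟩ := hV (W τ₁)
  refine ⟨fun t => if t ≤ τ₁ then W t else V (t - τ₁), ?_, ?_⟩
  · rw [isSolution_iff]
    have h := IsMild.concat (S := waveGroup d) h1 h2
      (hp.comp fun q => potentialOp (controlFunction q)) (isSolution_iff.1 hW)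
      (hq.comp fun q => potentialOp (controlFunction q)) (isSolution_iff.1 hV)
    simp only [apply_ite (fun q : ControlIndex d → ℝ => potentialOp (controlFunction q))]
    exact h
  · have hV0 := IsMild.apply_zero (S := waveGroup d) h2 (isSolution_iff.1 hV)
    beta_reduce
    split_ifs with h
    -- If the second leg has length zero, the final time falls in the first branch.
    · have h20 : τ₂ = 0 := by linarith
      rw [← hWF, ← hVG, h20, add_zero, hV0]
    · rw [add_sub_cancel_left, hVG, hWF]

theorem attainable_freeEvolution {τ : ℝ} (hτ : 0 ≤ τ) :
    Attainable τ (freeEvolution (d := d) τ) := by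
  refine ⟨hτ, (freeOp τ).continuous, fun _ => 0, isPiecewiseConstant_const hτ _, fun x => ?_⟩
  refine ⟨fun t => freeEvolution t x, ⟨(continuous_freeEvolution x).continuousOn, fun t _ => ?_⟩,
    rfl⟩
  have h0 : ∀ W : State d, controlOperator 0 W = 0 := by
    intro W
    change potentialOp (controlFunction 0) W = 0
    have : controlFunction (0 : ControlIndex d → ℝ) = 0 := by simp [controlFunction]
    rw [this, potentialOp_zero, _root_.zero_apply]
  simp only [h0, ← freeOp_apply, map_zero, intervalIntegral.integral_zero, add_zero]

/-- The states attainable from `x` in time less than `T`. -/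
def orbit (T : ℝ) (x : State d) : Set (State d) :=
  {y | ∃ τ F, τ < T ∧ Attainable τ F ∧ F x = y}

/-- A continuous flow that moves `y` to a point moves states near `y` to states near that point;
hence approximate steps can be chained. -/
theorem closure_orbit_trans {T₁ T₂ : ℝ} {x y z : State d} (hy : y ∈ closure (orbit T₁ x))
    (hz : z ∈ closure (orbit T₂ y)) : z ∈ closure (orbit (T₁ + T₂) x) := by
  refine closure_minimal ?_ isClosed_closure hz
  rintro _ ⟨τ, G, hτ, hG, rfl⟩
  refine map_mem_closure hG.2.1 hy ?_
  rintro _ ⟨σ, F, hσ, hF, rfl⟩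
  exact ⟨σ + τ, _, add_lt_add hσ hτ, hF.comp hG, rfl⟩

theorem freeEvolution_mem_closure_orbit {t T : ℝ} (ht : 0 ≤ t) (htT : t < T) (x : State d) :
    freeEvolution t x ∈ closure (orbit T x) :=
  subset_closure ⟨t, _, htT, attainable_freeEvolution ht, rfl⟩

/-- The jump `(w, v) ↦ (w, v + f w)` can be approximated in arbitrarily small time. -/
def Kickable (f : C(Torus d, ℝ)) : Prop :=
  ∀ T > 0, ∀ x : State d, x + potentialOp f x ∈ closure (orbit T x)

theorem Kickable.add {f g : C(Torus d, ℝ)} (hf : Kickable f) (hg : Kickable g) :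
    Kickable (f + g) := by
  intro T hT x
  have h := closure_orbit_trans (hf (T / 2) (half_pos hT) x)
    (hg (T / 2) (half_pos hT) (x + potentialOp f x))
  rwa [add_halves, map_add, potentialOp_potentialOp, add_zero, add_assoc,
    ← _root_.add_apply, ← potentialOp_add] at h

theorem kickable_zero : Kickable (0 : C(Torus d, ℝ)) := by
  intro T hT x
  rw [potentialOp_zero, _root_.zero_apply, add_zero]
  have := freeEvolution_mem_closure_orbit le_rfl hT x
  rwa [freeEvolution_zero] at this

theorem Kickable.nsmul {f : C(Torus d, ℝ)} (hf : Kickable f) (n : ℕ) : Kickable (n • f) := by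
  induction n with
  | zero => rw [zero_nsmul]; exact kickable_zero
  | succ n ih => rw [succ_nsmul]; exact ih.add hf

/-- The control `τ⁻¹ q` is applied for a short time `τ`. Smallness of `q` makes the Picard map a
contraction uniformly in `τ`, where `4` bounds `2 + 2 |t|` for `|t| ≤ 1`. -/
theorem kickable_controlFunction_of_small (q : ControlIndex d → ℝ)
    (hq : 4 * ‖controlFunction q‖ ≤ 1 / 2) : Kickable (controlFunction q) := by
  intro T hT x
  set B := potentialOp (controlFunction q)
  rw [Metric.mem_closure_iff]
  intro ε hε
  obtain ⟨δ, hδ0, hδ⟩ := exists_norm_sub_kick_lt (S := waveGroup d) B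
    (potentialOp_potentialOp _ _) x hε
  set τ := min (min δ T) 1 / 2
  have hm : 0 < min (min δ T) 1 := by positivity
  have hτ0 : 0 < τ := half_pos hm
  have hτm : τ < min (min δ T) 1 := half_lt_self hm
  have hτδ : τ < δ := hτm.trans_le ((min_le_left _ _).trans (min_le_left _ _))
  have hτT : τ < T := hτm.trans_le ((min_le_left _ _).trans (min_le_right _ _))
  have hτ1 : τ < 1 := hτm.trans_le (min_le_right _ _)
  have hC : potentialOp (controlFunction (τ⁻¹ • q)) = τ⁻¹ • B := by
    rw [controlFunction_smul, potentialOp_smul]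
  have hsol : ∀ x : State d, ∃ W, IsSolution τ (fun _ => τ⁻¹ • q) x W := by
    intro x
    simp only [isSolution_iff, hC]
    refine exists_isMild_const hτ0.le (M := 4) (fun t ht => ?_) _ ?_ x
    · exact (norm_freeOp_le t).trans (by linarith)
    · rw [← hC, controlFunction_smul]
      have h1 := norm_potentialOp_le (τ⁻¹ • controlFunction q)
      rw [norm_smul, Real.norm_of_nonneg (inv_nonneg.2 hτ0.le)] at h1
      calc _ ≤ 4 * (τ⁻¹ * ‖controlFunction q‖) * τ := by gcongr
        _ = 4 * ‖controlFunction q‖ := by field_simp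
        _ ≤ _ := hq
  obtain ⟨F, hF, hFW⟩ := exists_attainable hτ0.le (isPiecewiseConstant_const hτ0.le _) hsol
  refine ⟨F x, ⟨τ, F, hτT, hF, rfl⟩, ?_⟩
  obtain ⟨W, hW, hWF⟩ := hFW x
  simp only [isSolution_iff, hC] at hW
  rw [dist_comm, dist_eq_norm, ← hWF]
  exact hδ τ hτ0 hτδ W hW

/-- A large kick is a succession of `n` equal small ones. -/
theorem kickable_controlFunction (q : ControlIndex d → ℝ) : Kickable (controlFunction q) := by
  obtain ⟨n, hn⟩ := exists_nat_gt (8 * ‖controlFunction q‖)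
  have hn0 : (0 : ℝ) < n := (by positivity : (0 : ℝ) ≤ 8 * ‖controlFunction q‖).trans_lt hn
  have h : Kickable (controlFunction ((n : ℝ)⁻¹ • q)) := by
    refine kickable_controlFunction_of_small _ ?_
    rw [controlFunction_smul, norm_smul, norm_inv, Real.norm_of_nonneg hn0.le]
    field_simp
    linarith
  have h2 := h.nsmul n
  rwa [controlFunction_smul, ← Nat.cast_smul_eq_nsmul ℝ, smul_smul, mul_inv_cancel₀ hn0.ne',
    one_smul] at h2

/-- Conjugating the free evolution over a short time by strong kicks produces a negative square. -/
theorem tendsto_conj_freeEvolution {f : C(Torus d, ℝ)} (hf : IsMultiplier f) (x : State d) :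
    Tendsto (fun t : ℝ => freeEvolution t (x + potentialOp ((√t)⁻¹ • f) x) +
        potentialOp (-(√t)⁻¹ • f) (freeEvolution t (x + potentialOp ((√t)⁻¹ • f) x)))
      (𝓝[>] 0) (𝓝 (x + potentialOp (-(f * f)) x)) := by
  -- As `f` preserves `H¹`, the state `B x` has zero profile and `H¹` velocity, so `t ↦ S(t) B x` is
  -- differentiable from the right at `0`.
  set B := potentialOp f with hB
  obtain ⟨u, hu⟩ := hf.exists_H1 x.fst
  have hBx : B x = mkState 0 u.toL2 := by rw [hu, hB, potentialOp_apply]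
  have hslope := tendsto_freeEvolution_slope u
  rw [← hBx] at hslope
  have hsqrt : Tendsto (fun t : ℝ => √t) (𝓝[>] 0) (𝓝 0) := by
    have := Real.continuous_sqrt.tendsto 0
    rw [Real.sqrt_zero] at this
    exact this.mono_left nhdsWithin_le_nhds
  have h1 : Tendsto (fun t : ℝ => freeEvolution t x) (𝓝[>] 0) (𝓝 x) := by
    have := (continuous_freeEvolution x).tendsto 0
    rw [freeEvolution_zero] at this
    exact this.mono_left nhdsWithin_le_nhds
  have h2 := hsqrt.smul hslope
  have h3 : Tendsto (fun t : ℝ => (√t)⁻¹ • B (freeEvolution t x - x)) (𝓝[>] 0) (𝓝 0) := by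
    have hz : Tendsto (fun t : ℝ => √t * (‖f‖ * (2 * ‖x‖))) (𝓝[>] 0) (𝓝 0) := by
      simpa using hsqrt.mul_const (‖f‖ * (2 * ‖x‖))
    refine squeeze_zero_norm' ?_ hz
    filter_upwards [self_mem_nhdsWithin] with t ht
    have ht0 : (0 : ℝ) < t := ht
    have hs : 0 < √t := Real.sqrt_pos.2 ht0
    have hb : ‖B (freeEvolution t x - x)‖ ≤ ‖f‖ * (2 * t * ‖x‖) := by
      refine (norm_potentialOp_apply_le _ _).trans ?_
      gcongr
      have := norm_freeEvolution_fst_sub_le t x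
      rwa [abs_of_pos ht0, ← map_sub, ← WithLp.sub_fst] at this
    rw [norm_smul, norm_inv, Real.norm_of_nonneg hs.le]
    calc _ ≤ (√t)⁻¹ * (‖f‖ * (2 * t * ‖x‖)) := by gcongr
      _ = (√t)⁻¹ * (√t * √t) * (‖f‖ * (2 * ‖x‖)) := by
        rw [Real.mul_self_sqrt ht0.le]
        ring
      _ = _ := by rw [inv_mul_cancel_left₀ hs.ne']
  have h4 := (B.continuous.tendsto _).comp hslope
  -- With `D = t⁻¹ (S(t)Bx - Bx)`, the conjugated evolution equals `S(t)x + √t D - (√t)⁻¹ B(S(t)x -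
  -- x) - B D`: the two terms `± (√t)⁻¹ Bx` cancel, and `B² = 0` disposes of the rest. The first
  -- term tends to `x`, and `- B D` produces the negative square.
  have h5 := ((h1.add h2).sub h3).sub h4
  have hend : x + (0 : ℝ) • mkState u 0 - 0 - B (mkState u 0) = x + potentialOp (-(f * f)) x := by
    rw [zero_smul, add_zero, sub_zero, potentialOp_neg, _root_.neg_apply, ← sub_eq_add_neg,
      potentialOp_apply (f * f), mulL2_mul, ← hu, hB, potentialOp_apply, fst_mkState]
  rw [hend] at h5
  refine h5.congr' ?_
  filter_upwards [self_mem_nhdsWithin] with t ht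
  have ht0 : (0 : ℝ) < t := ht
  have hs : √t ≠ 0 := (Real.sqrt_pos.2 ht0).ne'
  have hsq : √t * t⁻¹ = (√t)⁻¹ := by
    rw [mul_inv_eq_iff_eq_mul₀ ht0.ne', eq_inv_mul_iff_mul_eq₀ hs, Real.mul_self_sqrt ht0.le]
  have hsq2 : t⁻¹ = (√t)⁻¹ * (√t)⁻¹ := by rw [← mul_inv, Real.mul_self_sqrt ht0.le]
  have hBB : B (B x) = 0 := potentialOp_potentialOp _ _ _
  simp only [Function.comp_apply, potentialOp_smul, _root_.smul_apply, ← hB, ← freeOp_apply,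
    map_add, map_smul, map_sub, hBB, smul_smul, hsq, smul_sub]
  rw [hsq2]
  module

/-- Kick, free evolution and opposite kick each take less than `T / 3`; the limit stays in the
closure. -/
theorem Kickable.neg_mul_self {f : C(Torus d, ℝ)} (hf : IsMultiplier f)
    (hk : ∀ c : ℝ, Kickable (c • f)) : Kickable (-(f * f)) := by
  intro T hT x
  refine isClosed_closure.mem_of_tendsto (tendsto_conj_freeEvolution hf x) ?_
  have h3 : 0 < T / 3 := by positivity
  filter_upwards [Ioo_mem_nhdsGT h3] with t ht
  have := closure_orbit_trans (closure_orbit_trans (hk (√t)⁻¹ _ h3 x)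
    (freeEvolution_mem_closure_orbit ht.1.le ht.2 _)) (hk (-(√t)⁻¹) _ h3 _)
  rwa [add_thirds] at this

/-! ### All trigonometric polynomials can be attained -/

/-- The multipliers of `H¹` all of whose multiples are small-time attainable kicks. -/
def kickSpace (d : ℕ) : Submodule ℝ C(Torus d, ℝ) where
  carrier := {f | IsMultiplier f ∧ ∀ c : ℝ, Kickable (c • f)}
  zero_mem' := by
    refine ⟨?_, fun c => by rw [smul_zero]; exact kickable_zero⟩
    simpa using (isMultiplier_trig (d := d) 0 0).smul 0
  add_mem' := fun hf hg =>
    ⟨hf.1.add hg.1, fun c => by rw [smul_add]; exact (hf.2 c).add (hg.2 c)⟩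
  smul_mem' := fun c f hf => ⟨hf.1.smul c, fun b => by rw [smul_smul]; exact hf.2 _⟩

theorem kickable_of_mem {f : C(Torus d, ℝ)} (hf : f ∈ kickSpace d) : Kickable f := by
  simpa using hf.2 1

theorem kickable_neg_mul_self_of_mem {f : C(Torus d, ℝ)} (hf : f ∈ kickSpace d) :
    Kickable (-(f * f)) := Kickable.neg_mul_self hf.1 hf.2

/-- Nonpositive multiples of `f²` are negative squares. For `c ≥ 0`, `c f² = c (f² + g²) - c g²`, a
two-sided kick followed by a negative square. -/
theorem mul_self_mem_kickSpace {f g : C(Torus d, ℝ)} (hf : f ∈ kickSpace d)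
    (hg : g ∈ kickSpace d) (h : f * f + g * g ∈ kickSpace d) : f * f ∈ kickSpace d := by
  have hneg : ∀ {f : C(Torus d, ℝ)} (c : ℝ), 0 ≤ c → f ∈ kickSpace d → Kickable (-(c • (f * f))) := by
    intro f c hc hf
    have := kickable_neg_mul_self_of_mem ((kickSpace d).smul_mem (√c) hf)
    rwa [smul_mul_smul_comm, Real.mul_self_sqrt hc] at this
  refine ⟨hf.1.mul hf.1, fun c => ?_⟩
  rcases le_total c 0 with hc | hc
  · have := hneg (-c) (by linarith) hf
    rwa [neg_smul, neg_neg] at this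
  · have := (h.2 c).add (hneg c hc hg)
    rwa [smul_add, add_neg_cancel_right] at this

/-- Polarisation: `c f g = -(f - (c/2) g)² + f² + (c/2)² g²`. -/
theorem mul_mem_kickSpace {f g : C(Torus d, ℝ)} (hf : f ∈ kickSpace d) (hg : g ∈ kickSpace d)
    (hff : f * f ∈ kickSpace d) (hgg : g * g ∈ kickSpace d) : f * g ∈ kickSpace d := by
  refine ⟨hf.1.mul hg.1, fun c => ?_⟩
  have h1 := kickable_neg_mul_self_of_mem
    ((kickSpace d).add_mem hf ((kickSpace d).smul_mem (-c / 2) hg))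
  have h2 := (h1.add (kickable_of_mem hff)).add
    (kickable_of_mem ((kickSpace d).smul_mem ((-c / 2) ^ 2) hgg))
  convert! h2 using 1
  ext x
  simp only [ContinuousMap.smul_apply, ContinuousMap.mul_apply, ContinuousMap.add_apply,
    ContinuousMap.neg_apply, smul_eq_mul]
  ring

theorem smul_lowMode_kickable (c : ℝ) (j : ControlIndex d) : Kickable (c • lowMode j) := by
  rw [← controlFunction_single]
  exact kickable_controlFunction _

theorem trig_neg (k : Fin d → ℤ) (a : ℂ) : trig (-k) a = trig k (conj a) := by
  ext x
  rw [trig_apply, trig_apply, monomial_neg, ← Complex.conj_re, map_mul, Complex.conj_conj]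

theorem trig_zero (a : ℂ) : trig (0 : Fin d → ℤ) a = a.re • lowMode (.inl ()) := by
  ext x
  simp [trig_apply, monomial_zero, lowMode]

theorem trig_single (i : Fin d) (a : ℂ) : trig (Pi.single i 1) a =
    a.re • lowMode (.inr (.inl i)) + (-a.im) • lowMode (.inr (.inr i)) := by
  ext x
  rw [trig_apply, monomial_single]
  simp only [lowMode, Complex.mul_re, ContinuousMap.add_apply, ContinuousMap.smul_apply,
    ContinuousMap.coe_mk, smul_eq_mul]
  ring

/-- The real part of a product, with imaginary parts written as `Im z = Re (-i z)`. -/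
theorem trig_add (k l : Fin d → ℤ) (a : ℂ) : trig (k + l) a =
    trig k a * trig l 1 - trig k (-Complex.I * a) * trig l (-Complex.I) := by
  ext x
  simp only [trig_apply, monomial_add, ContinuousMap.sub_apply, ContinuousMap.mul_apply,
    Complex.mul_re, Complex.mul_im, Complex.neg_re, Complex.neg_im, Complex.I_re, Complex.I_im,
    Complex.one_re, Complex.one_im]
  ring

/-- The identity `cos² + sin² = 1`, which supplies the hypothesis of `mul_self_mem_kickSpace`. -/
theorem trig_mul_self_add (k : Fin d → ℤ) (a : ℂ) :
    trig k a * trig k a + trig k (-Complex.I * a) * trig k (-Complex.I * a) =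
      trig 0 ((‖a‖ ^ 2 : ℝ) : ℂ) := by
  ext x
  have h : (a * monomial k x).re ^ 2 + (a * monomial k x).im ^ 2 = ‖a‖ ^ 2 := by
    rw [← mul_one ‖a‖, ← norm_monomial_apply k x, ← norm_mul, ← Complex.normSq_eq_norm_sq,
      Complex.normSq_apply]
    ring
  have h2 : (-Complex.I * a * monomial k x).re = (a * monomial k x).im := by
    rw [mul_assoc, Complex.mul_re]
    simp
  rw [ContinuousMap.add_apply, ContinuousMap.mul_apply, ContinuousMap.mul_apply]
  simp only [trig_apply, h2, monomial_zero, mul_one, Complex.ofReal_re]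
  linarith

theorem trig_zero_mem_kickSpace (a : ℂ) : trig (0 : Fin d → ℤ) a ∈ kickSpace d := by
  refine ⟨isMultiplier_trig 0 a, fun c => ?_⟩
  rw [trig_zero, smul_smul]
  exact smul_lowMode_kickable _ _

theorem trig_single_mem_kickSpace (i : Fin d) (a : ℂ) : trig (Pi.single i 1) a ∈ kickSpace d := by
  refine ⟨isMultiplier_trig _ a, fun c => ?_⟩
  rw [trig_single, smul_add, smul_smul, smul_smul]
  exact (smul_lowMode_kickable _ _).add (smul_lowMode_kickable _ _)

/-- The frequencies whose trigonometric functions are attainable kicks. -/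
def kickFrequencies (d : ℕ) : AddSubgroup (Fin d → ℤ) where
  carrier := {k | ∀ a, trig k a ∈ kickSpace d}
  zero_mem' := trig_zero_mem_kickSpace
  neg_mem' := fun h a => by
    rw [trig_neg]
    exact h _
  add_mem' := by
    intro k l hk hl a
    have hsq : ∀ {k : Fin d → ℤ}, (∀ a, trig k a ∈ kickSpace d) →
        ∀ a, trig k a * trig k a ∈ kickSpace d := by
      intro k hk a
      refine mul_self_mem_kickSpace (hk a) (hk (-Complex.I * a)) ?_
      rw [trig_mul_self_add]
      exact trig_zero_mem_kickSpace _
    rw [trig_add]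
    exact sub_mem (mul_mem_kickSpace (hk _) (hl _) (hsq hk _) (hsq hl _))
      (mul_mem_kickSpace (hk _) (hl _) (hsq hk _) (hsq hl _))

theorem trig_mem_kickSpace (k : Fin d → ℤ) (a : ℂ) : trig k a ∈ kickSpace d := by
  suffices h : k ∈ kickFrequencies d from h a
  have hk : k = ∑ i, k i • (Pi.single i 1 : Fin d → ℤ) := by
    ext j
    simp [Finset.sum_apply, Pi.single_apply]
  rw [hk]
  refine sum_mem fun i _ => zsmul_mem ?_ _
  exact fun a => trig_single_mem_kickSpace i a

theorem dense_kickSpace : Dense (kickSpace d : Set C(Torus d, ℝ)) := by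
  intro f
  -- The real part is only real linear; a free complex factor `a` lets the induction pass through
  -- complex multiples.
  have hre : ∀ g ∈ Submodule.span ℂ (range (monomial (d := d))), ∀ a : ℂ,
      reMap (a • g) ∈ kickSpace d := by
    intro g hg
    induction hg using Submodule.span_induction with
    | mem g hg =>
      obtain ⟨k, rfl⟩ := hg
      exact trig_mem_kickSpace k
    | zero =>
      intro a
      rw [smul_zero]
      exact zero_mem (kickSpace d)
    | add g h _ _ hg hh =>
      intro a
      have : reMap (a • (g + h)) = reMap (a • g) + reMap (a • h) := by
        ext x
        simp [reMap_apply]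
      rw [this]
      exact add_mem (hg a) (hh a)
    | smul c g _ hg =>
      intro a
      rw [smul_smul]
      exact hg _
  have hf : (⟨fun x => ((f x : ℝ) : ℂ), by fun_prop⟩ : C(Torus d, ℂ)) ∈
      closure (Submodule.span ℂ (range (monomial (d := d))) : Set C(Torus d, ℂ)) := by
    rw [← Submodule.topologicalClosure_coe, span_monomial_closure_eq_top]
    trivial
  rw [Metric.mem_closure_iff] at hf ⊢
  intro ε hε
  obtain ⟨g, hg, hfg⟩ := hf ε hε
  refine ⟨reMap g, by simpa using hre g hg 1, ?_⟩
  rw [ContinuousMap.dist_lt_iff hε] at hfg ⊢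
  intro x
  refine lt_of_le_of_lt ?_ (hfg x)
  rw [Real.dist_eq, Complex.dist_eq, reMap_apply]
  simpa using Complex.abs_re_le_norm ((f x : ℂ) - g x)

/-! ### Profiles in low dimension are bounded -/

theorem summable_inv_one_add_eigenvalue (hd : d < 2) :
    Summable fun k : Fin d → ℤ => (1 + eigenvalue k)⁻¹ := by
  interval_cases d
  · exact Summable.of_finite
  · rw [← (Equiv.funUnique (Fin 1) ℤ).symm.summable_iff]
    -- The term `1 / n ^ 2` is `0` at `n = 0` by convention, so the value `1` is added there.
    have h := (Real.summable_one_div_int_pow.2 one_lt_two).add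
      (hasSum_ite_eq (0 : ℤ) (1 : ℝ)).summable
    refine h.of_nonneg_of_le (fun n => inv_nonneg.2 ?_) fun n => ?_
    · linarith [eigenvalue_nonneg ((Equiv.funUnique (Fin 1) ℤ).symm n)]
    · have he : eigenvalue ((Equiv.funUnique (Fin 1) ℤ).symm n) = (n : ℝ) ^ 2 := by
        simp [eigenvalue]
      rw [Function.comp_apply, he]
      rcases eq_or_ne n 0 with rfl | hn
      · simp
      · have hn' : (0 : ℝ) < (n : ℝ) ^ 2 := by positivity
        rw [if_neg hn, add_zero, one_div]
        gcongr
        linarith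

/-- Young's inequality `c ≤ (1 + λ)⁻¹ + (1 + λ) c²`; the first term is summable only in low
dimension. -/
theorem summable_norm_coeff (hd : d < 2) (w : H1 d) : Summable fun k => ‖coeff w.toL2 k‖ := by
  refine ((summable_inv_one_add_eigenvalue hd).add (H1.hasSum_norm_sq w).summable).of_nonneg_of_le
    (fun k => norm_nonneg _) fun k => ?_
  have h : 0 < 1 + eigenvalue k := by linarith [eigenvalue_nonneg k]
  rw [← mul_le_mul_iff_right₀ h, mul_add, mul_inv_cancel₀ h.ne']
  nlinarith [sq_nonneg ((1 + eigenvalue k) * ‖coeff w.toL2 k‖ - 1),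
    mul_nonneg h.le (norm_nonneg (coeff w.toL2 k))]

theorem norm_eigenfunction_le (k : Fin d → ℤ) :
    ‖eigenfunction k‖ ≤ (2 * Real.pi) ^ (-(d : ℝ) / 2) := by
  have hp := Real.rpow_nonneg Real.two_pi_pos.le (-(d : ℝ) / 2)
  refine (ContinuousMap.norm_le _ hp).2 fun x => ?_
  rw [eigenfunction_apply, norm_mul, norm_monomial_apply, mul_one, Complex.norm_real,
    Real.norm_of_nonneg hp]

/-- In dimension at most one, the functions in `H¹` are continuous. -/
theorem exists_continuous_ae_eq (hd : d < 2) (w : H1 d) :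
    ∃ g : C(Torus d, ℝ), w.toL2 =ᵐ[volume] g := by
  have hs : Summable fun k => coeff w.toL2 k • (eigenfunction k : C(Torus d, ℂ)) := by
    refine Summable.of_norm_bounded
      ((summable_norm_coeff hd w).mul_right ((2 * Real.pi) ^ (-(d : ℝ) / 2))) fun k => ?_
    rw [norm_smul]
    gcongr
    exact norm_eigenfunction_le k
  obtain ⟨g, hg⟩ := hs
  have h1 := hg.mapL (ContinuousMap.toLp (E := ℂ) 2 (volume : Measure (Torus d)) ℂ)
  simp only [map_smul] at h1
  -- Uniform convergence implies `L²` convergence, so the continuous sum and `w` agree almost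
  -- everywhere.
  have h2 := h1.unique (hasSum_coeff_smul_eigenLp w.toL2)
  refine ⟨reMap g, ?_⟩
  filter_upwards [complexify_coeFn w.toL2, ContinuousMap.coeFn_toLp (p := 2) (E := ℂ) (𝕜 := ℂ)
    (volume : Measure (Torus d)) g] with x h3 h4
  rw [reMap_apply, ← h4, h2, h3, Complex.ofReal_re]

theorem memLp_mul_of_lt_two (hd : d < 2) (w : H1 d) (φ : L2 d) :
    MemLp (fun x => w.toL2 x * φ x) 2 (volume : Measure (Torus d)) := by
  obtain ⟨g, hg⟩ := exists_continuous_ae_eq hd w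
  refine (Lp.memLp (mulL2 g φ)).ae_eq ?_
  filter_upwards [mulL2_coeFn g φ, hg] with x h1 h2
  rw [h1, h2]

/-! ### Density in a weighted space -/

/-- The map `f ↦ w f` is isometric from `L²(|w|² dx)` to `L²(dx)`. As `|w|² dx` is a finite measure,
`φ` is approximated there by a continuous `g`, and `g` uniformly by an attainable kick. -/
theorem exists_norm_mulL2_sub_lt (w φ : L2 d) (h : MemLp (fun x => w x * φ x) 2 volume)
    {ε : ℝ} (hε : 0 < ε) : ∃ f ∈ kickSpace d, ‖mulL2 f w - h.toLp‖ < ε := by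
  set ρ : Torus d → ℝ≥0∞ := fun x => ‖w x‖ₑ ^ 2 with hρ
  have hρm : AEMeasurable ρ volume := (Lp.aestronglyMeasurable w).enorm.pow_const 2
  set μ := (volume : Measure (Torus d)).withDensity ρ with hμ
  have key : ∀ f : Torus d → ℝ, AEStronglyMeasurable f volume →
      eLpNorm f 2 μ = eLpNorm (fun x => w x * f x) 2 volume := by
    intro f hf
    rw [eLpNorm_eq_lintegral_rpow_enorm_toReal (by norm_num) (by norm_num),
      eLpNorm_eq_lintegral_rpow_enorm_toReal (by norm_num) (by norm_num)]
    congr 1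
    simp only [ENNReal.toReal_ofNat, ENNReal.rpow_ofNat]
    rw [hμ, lintegral_withDensity_eq_lintegral_mul₀ hρm (hf.enorm.pow_const 2)]
    refine lintegral_congr fun x => ?_
    rw [Pi.mul_apply, hρ, enorm_mul, mul_pow]
  have hfin : IsFiniteMeasure μ := by
    refine isFiniteMeasure_withDensity ?_
    have := lintegral_rpow_enorm_lt_top_of_eLpNorm_lt_top (by norm_num) (by norm_num)
      (Lp.memLp w).2
    simpa [hρ] using this.ne
  have hφm := Lp.aestronglyMeasurable φ
  have hφ : MemLp φ 2 μ :=
    ⟨hφm.mono_ac (withDensity_absolutelyContinuous _ _), by rw [key _ hφm]; exact h.2⟩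
  obtain ⟨g, hg, -⟩ := hφ.exists_boundedContinuous_eLpNorm_sub_le (by norm_num)
    (ENNReal.ofReal_pos.2 (half_pos hε)).ne'
  set δ := ε / (2 * (‖w‖ + 1)) with hδ
  have hδ0 : 0 < δ := by positivity
  obtain ⟨f, hf, hgf⟩ := Metric.mem_closure_iff.1 (dense_kickSpace g.toContinuousMap) δ hδ0
  refine ⟨f, hf, ?_⟩
  have h1 : ‖mulL2 g.toContinuousMap w - h.toLp‖ ≤ ε / 2 := by
    rw [Lp.norm_def]
    refine ENNReal.toReal_le_of_le_ofReal (half_pos hε).le ?_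
    rw [key _ (hφm.sub g.continuous.aestronglyMeasurable)] at hg
    rw [eLpNorm_congr_norm_ae (g := fun x => w x * (⇑φ - ⇑g) x)]
    · exact hg
    · filter_upwards [Lp.coeFn_sub (mulL2 g.toContinuousMap w) h.toLp, h.coeFn_toLp,
        mulL2_coeFn g.toContinuousMap w] with x h1 h2 h3
      rw [h1, Pi.sub_apply, h2, h3, Pi.sub_apply, mul_sub, norm_sub_rev]
      congr 2
      exact mul_comm _ _
  have h2 : ‖mulL2 f w - mulL2 g.toContinuousMap w‖ < ε / 2 := by
    have : mulL2 f w - mulL2 g.toContinuousMap w = mulL2 (f - g.toContinuousMap) w := by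
      rw [sub_eq_iff_eq_add, ← mulL2_add_left, sub_add_cancel]
    rw [this]
    rw [dist_comm, dist_eq_norm] at hgf
    calc _ ≤ ‖f - g.toContinuousMap‖ * ‖w‖ := norm_mulL2_le _ _
      _ ≤ δ * ‖w‖ := by gcongr
      _ < δ * (‖w‖ + 1) := by
        gcongr
        linarith
      _ = ε / 2 := by
        rw [hδ]
        field_simp
  calc _ ≤ _ := norm_sub_le_norm_sub_add_norm_sub _ (mulL2 g.toContinuousMap w) _
    _ < ε := by linarith

end TorusWave

end

/-! ### The main theorem -/

theorem mainTheorem5 (d : ℕ) (w₀ : TorusWave.H1 d) (v₀ φ : TorusWave.L2 d)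
    (hφ : 2 ≤ d → MemLp (fun x => w₀.toL2 x * φ x) 2 (volume : Measure (TorusWave.Torus d))) :
    ∃ h : MemLp (fun x => w₀.toL2 x * φ x) 2 (volume : Measure (TorusWave.Torus d)),
      ∀ ε > (0 : ℝ), ∀ T > (0 : ℝ), ∃ τ ∈ Ico 0 T, ∃ p : ℝ → TorusWave.ControlIndex d → ℝ,
        TorusWave.IsPiecewiseConstant τ p ∧
        (∃ W, TorusWave.IsSolution τ p (TorusWave.mkState w₀ v₀) W) ∧
        ∀ W, TorusWave.IsSolution τ p (TorusWave.mkState w₀ v₀) W →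
          ‖W τ - TorusWave.mkState w₀ (v₀ + h.toLp)‖ < ε := by
  have h : MemLp (fun x => w₀.toL2 x * φ x) 2 (volume : Measure (TorusWave.Torus d)) := by
    rcases lt_or_ge d 2 with hd | hd
    · exact TorusWave.memLp_mul_of_lt_two hd w₀ φ
    · exact hφ hd
  refine ⟨h, fun ε hε T hT => ?_⟩
  obtain ⟨f, hf, hfε⟩ := TorusWave.exists_norm_mulL2_sub_lt w₀.toL2 φ h (half_pos hε)
  set x := TorusWave.mkState w₀ v₀ with hx
  obtain ⟨_, ⟨τ, F, hτT, ⟨hτ0, -, p, hp, hW⟩, rfl⟩, hy⟩ :=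
    Metric.mem_closure_iff.1 (TorusWave.kickable_of_mem hf T hT x) (ε / 2) (half_pos hε)
  obtain ⟨V, hV, hVF⟩ := hW x
  refine ⟨τ, ⟨hτ0, hτT⟩, p, hp, ⟨V, hV⟩, fun W hW => ?_⟩
  -- Attainability provides one solution; uniqueness extends the estimate to every solution for this
  -- control.
  have hWV : W τ = F x := by
    rw [← hVF]
    exact TorusWave.IsMild.unique (S := TorusWave.waveGroup d) hτ0
      (hp.comp fun q => TorusWave.potentialOp (TorusWave.controlFunction q))
      (TorusWave.isSolution_iff.1 hW) (TorusWave.isSolution_iff.1 hV)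
  rw [hWV]
  rw [dist_comm, dist_eq_norm] at hy
  have h1 : x + TorusWave.potentialOp f x - TorusWave.mkState w₀ (v₀ + h.toLp) =
      TorusWave.mkState 0 (TorusWave.mulL2 f w₀.toL2 - h.toLp) := by
    rw [TorusWave.potentialOp_apply, hx, ← WithLp.toLp_add, ← WithLp.toLp_sub, Prod.mk_add_mk,
      Prod.mk_sub_mk, add_zero, sub_self, add_sub_add_left_eq_sub]
    rfl
  have h2 : ‖x + TorusWave.potentialOp f x - TorusWave.mkState w₀ (v₀ + h.toLp)‖ < ε / 2 := by
    rw [h1, TorusWave.norm_mkState_zero]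
    exact hfε
  calc _ ≤ _ := norm_sub_le_norm_sub_add_norm_sub _ (x + TorusWave.potentialOp f x) _
    _ < ε := by linarith
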